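/- A numbered group $(G,\nu)$ is a group $G$ with a surjection $\nu:\mathbb N\to G$; it is a computable group if $\{(i,j,k):\nu(i)\nu(j)=\nu(k)\}$ is decidable. A subset $S\subseteq G$ is computable if $\nu^{-1}(S)$ is decidable. Finite subsets of $G$ are given to algorithms by finite lists of $\nu$-numbers of their elements. For a finite $K_0\subset G$ and an integer $n\ge 1$ consider the condition $(*)_{K_0,n}$: for every non-empty finite $F\subset G$ there is $k\in K_0$ with $\dfrac{|F\setminus kF|}{|F|}\ge \dfrac1n$. An effective paradoxical decomposition of $(G,\nu)$ consists of a finite set $K\subset G$ and two families $(A_k)_{k\in K}$, $(B_k)_{k\in K}$ of computable (possibly empty) subsets of $G$ with $$G=\Big(\bigsqcup_{k\in K}kA_k\Big)\sqcup\Big(\bigsqcup_{k\in K}kB_k\Big)=\bigsqcup_{k\in K}A_k=\bigsqcup_{k\in K}B_k .$$ To find such a decomposition means to output a list of numbers of the elements of $K$ together with, for each $k\in K$, programs deciding $\nu^{-1}(A_k)$ and $\nu^{-1}(B_k)$. Theorem. (1) For every computable group $(G,\nu)$ there is an effective procedure (a partial computable function) which, for any finite $K_0\subset G$ such that $(*)_{K_0,n}$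 holds for some $n\ge1$, halts on $K_0$ and finds an effective paradoxical decomposition of $(G,\nu)$. (2) Moreover, there is a single effective procedure, independent of the group, which, given a program deciding the multiplication table of any computable group $(G,\nu)$, a finite $K_0\subset G$ and an $n\ge1$ with $(*)_{K_0,n}$, halts and finds an effective paradoxical decomposition of $(G,\nu)$. -/

import Mathlib

universe u

open scoped Pointwise

/-- The multiplication table `MultT` of a numbered group: the triples `(i, j, k)` with
`ν i * ν j = ν k`. -/
def MultT {G : Type*} [Group G] (ν : ℕ → G) : ℕ × ℕ × ℕ → Prop :=
  fun t => ν t.1 * ν t.2.1 = ν t.2.2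

/-- `(G, ν)` is a computable group: `ν` is a numbering (a surjection from `ℕ`) and the
multiplication table is decidable. -/
structure IsComputableGroup {G : Type*} [Group G] (ν : ℕ → G) : Prop where
  surjective : Function.Surjective ν
  computable_multT : ComputablePred (MultT ν)

/-- The program `c` is a decision procedure for `p`: it halts on every input, with
answer `1` where `p` holds and answer `0` where it fails. -/
def Decides {α : Type*} [Encodable α] (c : Nat.Partrec.Code) (p : α → Prop) : Prop :=
  ∀ a : α, (p a → 1 ∈ c.eval (Encodable.encode a)) ∧ (¬ p a → 0 ∈ c.eval (Encodable.encode a))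

open Classical in
/-- `n ≥ 1`, and every non-empty finite `F ⊆ G` has some `k ∈ K₀` with
`|F \ kF| / |F| ≥ 1 / n`. -/
def FailsFolner {G : Type*} [Group G] (K₀ : Finset G) (n : ℕ) : Prop :=
  0 < n ∧ ∀ F : Finset G, F.Nonempty →
    ∃ k ∈ K₀, (1 : ℝ) / n ≤ ((F \ (k • F)).card : ℝ) / (F.card : ℝ)

/-- `(K, (A k), (B k))`, with `k` ranging over `K`, is a paradoxical decomposition of `G`. Some of
the pieces may be empty, and the values of `A` and `B` outside `K` play no role. -/
structure IsParadoxicalDecomposition {G : Type*} [Group G] (K : Finset G) (A B : G → Set G) :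
    Prop where
  disjoint_left : (K : Set G).PairwiseDisjoint A
  union_left : ⋃ k ∈ K, A k = Set.univ
  disjoint_right : (K : Set G).PairwiseDisjoint B
  union_right : ⋃ k ∈ K, B k = Set.univ
  disjoint_smul_left : (K : Set G).PairwiseDisjoint (fun k => k • A k)
  disjoint_smul_right : (K : Set G).PairwiseDisjoint (fun k => k • B k)
  disjoint_smul : Disjoint (⋃ k ∈ K, k • A k) (⋃ k ∈ K, k • B k)
  union_smul : (⋃ k ∈ K, k • A k) ∪ (⋃ k ∈ K, k • B k) = Set.univ

/-- The finite set `S ⊆ G` is given by the list `l` of numbers of its elements. -/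
def IsListOf {G : Type*} (ν : ℕ → G) (l : List ℕ) (S : Finset G) : Prop :=
  (S : Set G) = {g | ∃ i ∈ l, ν i = g}

/-- The list `out` of triples (number of `k`, program, program) presents an effective paradoxical
decomposition `(K, (A k), (B k))` of `(G, ν)`: its first entries list `K`, and its second and third
entries are decision procedures for the sets of numbers of elements of `A k` and of `B k`. -/
def PresentsEffectiveParadoxicalDecomposition {G : Type*} [Group G] (ν : ℕ → G)
    (out : List (ℕ × Nat.Partrec.Code × Nat.Partrec.Code)) : Prop :=
  ∃ (K : Finset G) (A B : G → Set G),
    IsParadoxicalDecomposition K A B ∧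
    IsListOf ν (out.map Prod.fst) K ∧
    ∀ t ∈ out, Decides t.2.1 (fun i : ℕ => ν i ∈ A (ν t.1)) ∧
      Decides t.2.2 (fun i : ℕ => ν i ∈ B (ν t.1))

/-! Put `K = (K₀ ∪ {1}) ^ (2 * n)`. Failure of the Følner condition makes each multiplication by `K₀
∪ {1}` enlarge a finite set by a factor `1 + 1 / n`, so Bernoulli's inequality gives `|K F| ≥ 4
|F|`. Join each of two copies of `x ∈ G` to all `k x`, `k ∈ K`, in one further copy of `G`. In this
bipartite graph finite sets at least double on both sides. A perfect matching consists of two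
injections `φ, ψ : G → G` whose images partition `G`, with `φ x, ψ x ∈ K x`; the pieces are `A k =
{x | k x = φ x}` and `B k = {x | k x = ψ x}`.

The difficulty is to compute such a matching, since Hall's theorem for infinite graphs is not
effective. The matching is built by back-and-forth, keeping Hall's condition on both sides after
removal of the finitely many matched vertices. A suitable next edge always exists: Hall's theorem on
both sides, combined by a Schröder–Bernstein argument, extends the current finite matching to a
perfect one (`HallOutside.exists_extension`). It can be found because doubling makes the preserved
condition decidable: a violating set would be smaller than the set of removed right vertices, and
its part far from them can be cut off, so a matching of one finite ball certifies the condition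
(`HallOutside.of_ball`), while a finite violating set refutes it.

Uniformity is handled by indexing families by valid inputs, hypotheses included, while the program
sees only the code `π i`. Every function is total on valid inputs, so unbounded searches are
justified by facts about the group; on other codes the program may diverge.

In part (1) no `n` is supplied. One fixed pair `K₁, n₁` for the group is built into the procedure
and `K₀ ∪ K₁` is used instead of `K₀`. -/

/-! ### Families of total functions computed by one partial recursive function -/

section Uniform

variable {ι Γ α β γ σ : Type*} [Primcodable Γ] [Primcodable α] [Primcodable β] [Primcodable γ]
  [Primcodable σ] {π : ι → Γ}

/-- A family `f i : α → σ` of total functions is uniformly computable with respect to the codes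
`π i` of the parameters if one partial recursive function computes `f i a` from `π i` and `a`. -/
def UnifComputable (π : ι → Γ) (f : ι → α → σ) : Prop :=
  ∃ F : Γ × α →. σ, Partrec F ∧ ∀ i a, F (π i, a) = Part.some (f i a)

open Classical in
/-- A family of predicates is uniformly decidable if its characteristic functions are uniformly
computable. -/
def UnifDecidable (π : ι → Γ) (P : ι → α → Prop) : Prop :=
  UnifComputable π fun i a => decide (P i a)

/-! ### Closure properties of uniformly computable families. -/

namespace UnifComputable

theorem of_eq {f g : ι → α → σ} (hf : UnifComputable π f) (h : ∀ i a, f i a = g i a) :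
    UnifComputable π g := by
  obtain rfl : f = g := funext fun i => funext (h i)
  exact hf

theorem of_computable {f : α → σ} (hf : Computable f) : UnifComputable π fun _ => f :=
  ⟨fun x => Part.some (f x.2), (hf.comp Computable.snd).partrec, fun _ _ => rfl⟩

theorem param {f : Γ → σ} (hf : Computable f) : UnifComputable π fun i (_ : α) => f (π i) :=
  ⟨fun x => Part.some (f x.1), (hf.comp Computable.fst).partrec, fun _ _ => rfl⟩

theorem comp {f : ι → β → σ} {g : ι → α → β} (hf : UnifComputable π f)
    (hg : UnifComputable π g) : UnifComputable π fun i a => f i (g i a) := by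
  obtain ⟨F, hF, hF'⟩ := hf
  obtain ⟨G, hG, hG'⟩ := hg
  refine ⟨fun x => (G x).bind fun b => F (x.1, b), hG.bind ?_, fun i a => ?_⟩
  · exact hF.comp ((Computable.fst.comp Computable.fst).pair Computable.snd)
  · simp [hG', hF']

theorem pair {f : ι → α → β} {g : ι → α → σ} (hf : UnifComputable π f)
    (hg : UnifComputable π g) : UnifComputable π fun i a => (f i a, g i a) := by
  obtain ⟨F, hF, hF'⟩ := hf
  obtain ⟨G, hG, hG'⟩ := hg
  refine ⟨fun x => (F x).bind fun b => (G x).map fun c => (b, c), hF.bind (Partrec.map ?_ ?_),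
    fun i a => ?_⟩
  · exact hG.comp Computable.fst
  · exact (Computable.snd.comp Computable.fst).pair Computable.snd
  · simp [hG', hF']

theorem const (c : σ) : UnifComputable π fun _ (_ : α) => c := of_computable (Computable.const c)

theorem id : UnifComputable π fun _ (a : α) => a := of_computable Computable.id

theorem fst : UnifComputable π fun _ (x : α × β) => x.1 := of_computable Computable.fst

theorem snd : UnifComputable π fun _ (x : α × β) => x.2 := of_computable Computable.snd

theorem nat_rec {n : ι → α → ℕ} {f : ι → α → σ} {h : ι → α → ℕ → σ → σ}
    (hn : UnifComputable π n) (hf : UnifComputable π f)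
    (hh : UnifComputable π fun i (x : α × ℕ × σ) => h i x.1 x.2.1 x.2.2) :
    UnifComputable π fun i a => Nat.rec (motive := fun _ => σ) (f i a) (h i a) (n i a) := by
  obtain ⟨N, hN, hN'⟩ := hn
  obtain ⟨F, hF, hF'⟩ := hf
  obtain ⟨H, hH, hH'⟩ := hh
  have key : Partrec₂ fun (x : Γ × α) (n : ℕ) => (Nat.rec (F x)
      (fun y ih => ih.bind fun s => H (x.1, x.2, y, s)) n : Part σ) := by
    refine Partrec.nat_rec (h := fun (x : (Γ × α) × ℕ) (y : ℕ × σ) => H (x.1.1, x.1.2, y.1, y.2))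
      Computable.snd (hF.comp Computable.fst) ?_
    refine hH.comp (Computable.pair ?_ (Computable.pair ?_ Computable.snd))
    · exact Computable.fst.comp (Computable.fst.comp Computable.fst)
    · exact Computable.snd.comp (Computable.fst.comp Computable.fst)
  refine ⟨fun x => (N x).bind fun n => Nat.rec (F x)
    (fun y ih => ih.bind fun s => H (x.1, x.2, y, s)) n, hN.bind key, fun i a => ?_⟩
  simp only [hN', Part.bind_some]
  induction n i a with
  | zero => simp [hF']
  | succ k ih =>
    change Part.bind (Nat.rec _ _ k) _ = _
    rw [ih, Part.bind_some, hH']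

/-- Both branches may be evaluated before choosing, because the families are total. -/
theorem cond {c : ι → α → Bool} {f g : ι → α → σ} (hc : UnifComputable π c)
    (hf : UnifComputable π f) (hg : UnifComputable π g) :
    UnifComputable π fun i a => bif c i a then f i a else g i a :=
  (of_computable (f := fun x : Bool × σ × σ => bif x.1 then x.2.1 else x.2.2)
    (Computable.cond Computable.fst (Computable.fst.comp Computable.snd)
      (Computable.snd.comp Computable.snd))).comp (hc.pair (hf.pair hg))

open Classical in
theorem ite {P : ι → α → Prop} {f g : ι → α → σ} (hP : UnifDecidable π P)
    (hf : UnifComputable π f) (hg : UnifComputable π g) :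
    UnifComputable π fun i a => if P i a then f i a else g i a :=
  (cond hP hf hg).of_eq fun i a => by by_cases h : P i a <;> simp [h]

theorem option_casesOn {o : ι → α → Option β} {f : ι → α → σ} {g : ι → α → β → σ}
    (ho : UnifComputable π o) (hf : UnifComputable π f)
    (hg : UnifComputable π fun i (x : α × β) => g i x.1 x.2) :
    UnifComputable π fun i a => (o i a).elim (f i a) (g i a) := by
  obtain ⟨O, hO, hO'⟩ := ho
  obtain ⟨F, hF, hF'⟩ := hf
  obtain ⟨H, hH, hH'⟩ := hg
  -- `Partrec.optionCasesOn_right` allows partiality only in the `some` branch. The default value is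
  -- therefore computed beforehand, which is harmless since it always exists.
  have key : Partrec fun y : ((Γ × α) × Option β) × σ =>
      (Option.casesOn y.1.2 (Part.some y.2) fun b => H (y.1.1.1, y.1.1.2, b) : Part σ) := by
    refine Partrec.optionCasesOn_right (Computable.snd.comp Computable.fst) Computable.snd
      (hH.comp ((Computable.pair ?_ (Computable.pair ?_ Computable.snd))))
    · exact Computable.fst.comp (Computable.fst.comp (Computable.fst.comp Computable.fst))
    · exact Computable.snd.comp (Computable.fst.comp (Computable.fst.comp Computable.fst))
  have key' : Partrec₂ fun (x : Γ × α) (b : Option β) => (F x).bind fun s =>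
      (Option.casesOn b (Part.some s) fun b => H (x.1, x.2, b) : Part σ) :=
    Partrec.bind (hF.comp Computable.fst) key
  refine ⟨fun x => (O x).bind fun b => (F x).bind fun s =>
    (Option.casesOn b (Part.some s) fun b => H (x.1, x.2, b) : Part σ), hO.bind key',
    fun i a => ?_⟩
  rcases h : o i a <;> simp [hO', hF', hH', h]

theorem list_foldl {l : ι → α → List β} {f : ι → α → σ} {h : ι → α → σ → β → σ}
    (hl : UnifComputable π l) (hf : UnifComputable π f)
    (hh : UnifComputable π fun i (x : α × σ × β) => h i x.1 x.2.1 x.2.2) :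
    UnifComputable π fun i a => (l i a).foldl (h i a) (f i a) := by
  have hstep : UnifComputable π fun i (x : α × ℕ × σ) =>
      ((l i x.1)[x.2.1]?).elim x.2.2 (h i x.1 x.2.2) := by
    refine option_casesOn ?_ (snd.comp snd) ?_
    · exact (of_computable Computable.list_getElem?).comp ((hl.comp fst).pair (fst.comp snd))
    · exact hh.comp ((fst.comp fst).pair ((snd.comp (snd.comp fst)).pair snd))
  refine (nat_rec (h := fun i a n s => ((l i a)[n]?).elim s (h i a s))
    ((of_computable Computable.list_length).comp hl) hf hstep).of_eq fun i a => ?_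
  -- After `n` steps the recursion has folded the first `n` entries; an index out of range would
  -- leave the state unchanged.
  have : ∀ n, (Nat.rec (f i a) (fun n s => ((l i a)[n]?).elim s (h i a s)) n : σ) =
      ((l i a).take n).foldl (h i a) (f i a) := by
    intro n
    induction n with
    | zero => rfl
    | succ n ih =>
      simp only [ih, List.take_add_one, List.foldl_append]
      rcases (l i a)[n]? <;> rfl
  rw [this, List.take_length]

theorem list_flatMap {l : ι → α → List β} {f : ι → α → β → List σ} (hl : UnifComputable π l)
    (hf : UnifComputable π fun i (x : α × β) => f i x.1 x.2) :
    UnifComputable π fun i a => (l i a).flatMap (f i a) := by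
  refine (list_foldl (h := fun i a s b => s ++ f i a b) hl (const []) ?_).of_eq fun i a => ?_
  · exact (of_computable Computable.list_append).comp
      ((fst.comp snd).pair (hf.comp (fst.pair (snd.comp snd))))
  · have : ∀ s, (l i a).foldl (fun s b => s ++ f i a b) s = s ++ (l i a).flatMap (f i a) := by
      induction l i a with
      | nil => simp
      | cons b t ih => intro s; simp [ih]
    simpa using this []

theorem list_map {l : ι → α → List β} {f : ι → α → β → σ} (hl : UnifComputable π l)
    (hf : UnifComputable π fun i (x : α × β) => f i x.1 x.2) :
    UnifComputable π fun i a => (l i a).map (f i a) :=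
  (list_flatMap (f := fun i a b => [f i a b]) hl
    ((of_computable (Computable.list_cons.comp Computable.id (Computable.const []))).comp
      hf)).of_eq fun i a => by
    induction l i a <;> simp_all

theorem list_cons {f : ι → α → σ} {l : ι → α → List σ} (hf : UnifComputable π f)
    (hl : UnifComputable π l) : UnifComputable π fun i a => f i a :: l i a :=
  (of_computable Computable.list_cons).comp (hf.pair hl)

/-- Unbounded search: the existence hypothesis, needed only for genuine indices `i`, makes it halt.
-/
theorem sInf {P : ι → α → ℕ → Prop} (hP : UnifDecidable π fun i (x : α × ℕ) => P i x.1 x.2)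
    (h : ∀ i a, ∃ n, P i a n) : UnifComputable π fun i a => sInf {n | P i a n} := by
  classical
  obtain ⟨F, hF, hF'⟩ := hP
  refine ⟨fun x => Nat.rfind fun n => F (x.1, x.2, n), Partrec.rfind (hF.comp ?_), fun i a => ?_⟩
  · exact (Computable.fst.comp Computable.fst).pair
      ((Computable.snd.comp Computable.fst).pair Computable.snd)
  · refine Part.eq_some_iff.2 (Nat.mem_rfind.2 ?_)
    refine ⟨?_, fun {m} hm => ?_⟩
    · simpa [hF'] using Nat.sInf_mem (s := {n | P i a n}) (h i a)
    · simpa [hF'] using Nat.notMem_of_lt_sInf hm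

end UnifComputable

/-! ### Closure properties of uniformly decidable families. -/

namespace UnifDecidable

open UnifComputable

theorem of_iff {P Q : ι → α → Prop} (hP : UnifDecidable π P) (h : ∀ i a, P i a ↔ Q i a) :
    UnifDecidable π Q := by
  obtain rfl : P = Q := funext fun i => funext fun a => propext (h i a)
  exact hP

theorem of_computable {p : α → Bool} (hp : Computable p) : UnifDecidable π fun _ a => p a = true :=
  (UnifComputable.of_computable hp).of_eq fun i a => by simp

theorem of_primrecPred {p : α → Prop} (hp : PrimrecPred p) : UnifDecidable π fun _ => p := by
  obtain ⟨_, hp⟩ := hp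
  exact (of_computable hp.to_comp).of_iff fun i a => by simp

theorem comp {P : ι → β → Prop} {g : ι → α → β} (hP : UnifDecidable π P)
    (hg : UnifComputable π g) : UnifDecidable π fun i a => P i (g i a) :=
  UnifComputable.comp hP hg

theorem not {P : ι → α → Prop} (hP : UnifDecidable π P) : UnifDecidable π fun i a => ¬ P i a :=
  ((UnifComputable.of_computable Primrec.not.to_comp).comp hP).of_eq fun i a => by simp

theorem and {P Q : ι → α → Prop} (hP : UnifDecidable π P) (hQ : UnifDecidable π Q) :
    UnifDecidable π fun i a => P i a ∧ Q i a :=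
  ((UnifComputable.of_computable Primrec.and.to_comp).comp (hP.pair hQ)).of_eq fun i a => by
    by_cases h : P i a <;> by_cases h' : Q i a <;> simp [h, h']

theorem or {P Q : ι → α → Prop} (hP : UnifDecidable π P) (hQ : UnifDecidable π Q) :
    UnifDecidable π fun i a => P i a ∨ Q i a :=
  ((UnifComputable.of_computable Primrec.or.to_comp).comp (hP.pair hQ)).of_eq fun i a => by
    by_cases h : P i a <;> by_cases h' : Q i a <;> simp [h, h']

theorem eq {f g : ι → α → σ} (hf : UnifComputable π f) (hg : UnifComputable π g) :
    UnifDecidable π fun i a => f i a = g i a :=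
  (of_primrecPred Primrec.eq).comp (hf.pair hg)

theorem exists_mem_list {l : ι → α → List β} {P : ι → α → β → Prop} (hl : UnifComputable π l)
    (hP : UnifDecidable π fun i (x : α × β) => P i x.1 x.2) :
    UnifDecidable π fun i a => ∃ b ∈ l i a, P i a b := by
  classical
  refine (eq (list_flatMap (f := fun i a b => if P i a b then [()] else []) hl
    (ite hP (const [()]) (const []))) (const [])).not.of_iff fun i a => ?_
  simp

theorem forall_mem_list {l : ι → α → List β} {P : ι → α → β → Prop} (hl : UnifComputable π l)
    (hP : UnifDecidable π fun i (x : α × β) => P i x.1 x.2) :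
    UnifDecidable π fun i a => ∀ b ∈ l i a, P i a b :=
  (exists_mem_list hl (P := fun i a b => ¬ P i a b) hP.not).not.of_iff fun i a => by simp

theorem mem_list {f : ι → α → β} {l : ι → α → List β} (hf : UnifComputable π f)
    (hl : UnifComputable π l) : UnifDecidable π fun i a => f i a ∈ l i a :=
  (exists_mem_list (P := fun i a b => b = f i a) hl (eq snd (hf.comp fst))).of_iff
    fun i a => by simp

theorem decode_toList : UnifComputable π
    fun _ (x : α × ℕ) => (Encodable.decode x.2 : Option β).toList :=
  (UnifComputable.of_computable (Primrec.optionToList.comp Primrec.decode).to_comp).comp snd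

/-- A predicate is uniformly decidable if it and its negation are witnessed by uniformly decidable
relations. -/
theorem of_witnesses {P : ι → α → Prop} {Q : ι → α → β → Prop} {R : ι → α → γ → Prop}
    (hQ : UnifDecidable π fun i (x : α × β) => Q i x.1 x.2)
    (hR : UnifDecidable π fun i (x : α × γ) => R i x.1 x.2)
    (h : ∀ i a, P i a ↔ ∃ w, Q i a w) (h' : ∀ i a, ¬ P i a ↔ ∃ w, R i a w) :
    UnifDecidable π P := by
  have hQ' : UnifDecidable π fun i (x : α × ℕ) =>
      ∃ w ∈ (Encodable.decode x.2 : Option β).toList, Q i x.1 w :=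
    exists_mem_list (P := fun i x w => Q i x.1 w) decode_toList (hQ.comp ((fst.comp fst).pair snd))
  have hR' : UnifDecidable π fun i (x : α × ℕ) =>
      ∃ w ∈ (Encodable.decode x.2 : Option γ).toList, R i x.1 w :=
    exists_mem_list (P := fun i x w => R i x.1 w) decode_toList (hR.comp ((fst.comp fst).pair snd))
  -- One search over codes looks for either kind of witness; the answer is read off from the kind
  -- found.
  have ex : ∀ i a, ∃ n, (∃ w ∈ (Encodable.decode n : Option β).toList, Q i a w) ∨
      ∃ w ∈ (Encodable.decode n : Option γ).toList, R i a w := by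
    intro i a
    by_cases hP : P i a
    · obtain ⟨w, hw⟩ := (h i a).1 hP
      exact ⟨Encodable.encode w, Or.inl ⟨w, by simp, hw⟩⟩
    · obtain ⟨w, hw⟩ := (h' i a).1 hP
      exact ⟨Encodable.encode w, Or.inr ⟨w, by simp, hw⟩⟩
  have hn := UnifComputable.sInf (P := fun i a n =>
    (∃ w ∈ (Encodable.decode n : Option β).toList, Q i a w) ∨
      ∃ w ∈ (Encodable.decode n : Option γ).toList, R i a w) (hQ'.or hR') ex
  refine (hQ'.comp (UnifComputable.id.pair hn)).of_iff fun i a => ⟨?_, fun hP => ?_⟩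
  · rintro ⟨w, -, hw⟩
    exact (h i a).2 ⟨w, hw⟩
  · rcases Nat.sInf_mem (ex i a) with hw | ⟨w, -, hw⟩
    · exact hw
    · exact absurd hP ((h' i a).2 ⟨w, hw⟩)

end UnifDecidable

end Uniform

/-! ### Hall's condition away from finitely many vertices -/

section Hall

variable {α β : Type*} [DecidableEq α] [DecidableEq β]

/-- Hall's condition for the bipartite graph `N` with the vertices of `D` and `R` removed. -/
def HallOutside (N : α → Finset β) (D : Finset α) (R : Finset β) : Prop :=
  ∀ X : Finset α, Disjoint X D → X.card ≤ (X.biUnion N \ R).card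

/-- Hall's marriage theorem for a possibly infinite family of finite sets, indexed by the vertices
outside `D`. -/
theorem hallOutside_iff_exists_injective {N : α → Finset β} {D : Finset α} {R : Finset β} :
    HallOutside N D R ↔
      ∃ f : {a // a ∉ D} → β, Function.Injective f ∧ ∀ a : {a // a ∉ D}, f a ∈ N a ∧ f a ∉ R := by
  have key := Finset.all_card_le_biUnion_card_iff_exists_injective
    (fun a : {a // a ∉ D} => N a \ R)
  simp only [Finset.mem_sdiff] at key
  rw [← key]
  constructor
  · intro h s
    have := h (s.map (Function.Embedding.subtype _)) (by
      rw [Finset.disjoint_left]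
      simp +contextual)
    rw [Finset.card_map] at this
    refine this.trans (Finset.card_le_card fun x hx => ?_)
    simp only [Finset.mem_sdiff, Finset.mem_biUnion, Finset.mem_map,
      Function.Embedding.coe_subtype] at hx ⊢
    obtain ⟨⟨_, ⟨a, ha, rfl⟩, hx⟩, hR⟩ := hx
    exact ⟨a, ha, hx, hR⟩
  · intro h X hX
    have := h (X.subtype fun a => a ∉ D)
    rw [Finset.card_subtype, Finset.filter_true_of_mem fun a ha => Finset.disjoint_left.1 hX ha]
      at this
    refine this.trans (Finset.card_le_card fun x hx => ?_)
    simp only [Finset.mem_sdiff, Finset.mem_biUnion, Finset.mem_subtype] at hx ⊢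
    obtain ⟨a, ha, hx, hR⟩ := hx
    exact ⟨⟨a, ha, hx⟩, hR⟩

/-- In a graph where every finite set at least doubles, Hall's condition outside `D` and `R` can be
tested on the subsets of a ball around `R` whose radius is bounded by the size of `R`. -/
theorem HallOutside.of_ball {N : α → Finset β} {N' : β → Finset α}
    (sym : ∀ a c, c ∈ N a ↔ a ∈ N' c) (hexp : ∀ X : Finset α, 2 * X.card ≤ (X.biUnion N).card)
    {D : Finset α} {R : Finset β} {B : ℕ → Finset α} (h0 : ∀ c ∈ R, N' c ⊆ B 0)
    (hB : ∀ j, B j ⊆ B (j + 1)) (hN : ∀ j, ∀ a ∈ B j, ∀ c ∈ N a, N' c ⊆ B (j + 1))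
    {m : ℕ} (hm : R.card ≤ m)
    (hloc : ∀ X : Finset α, X ⊆ B m → Disjoint X D → X.card ≤ (X.biUnion N \ R).card) :
    HallOutside N D R := by
  intro X hX
  by_contra hviol
  push Not at hviol
  have mono : Monotone B := monotone_nat_of_le_succ hB
  -- Doubling gives `2|X| - |R| ≤ |N(X) \ R| < |X|`, hence `|X| < |R| ≤ m`; so `X` misses one of the
  -- `m` disjoint layers below.
  have hcard : X.card < m := by
    have h1 := hexp X
    have h2 := Finset.le_card_sdiff R (X.biUnion N)
    omega
  obtain ⟨j, hj, hlayer⟩ : ∃ j < m, X ∩ (B (j + 1) \ B j) = ∅ := by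
    by_contra hne
    push Not at hne
    have : Nonempty α := (Finset.card_pos.1 (Nat.zero_lt_of_lt hviol)).to_subtype.map Subtype.val
    choose! g hg using fun j hj => (hne j hj)
    have hinj : Set.InjOn g (Finset.range m : Set ℕ) := by
      have : ∀ j < m, ∀ k < m, g j = g k → ¬ j < k := by
        intro j hj k hk e hjk
        have h1 := hg j hj
        have h2 := hg k hk
        simp only [Finset.mem_inter, Finset.mem_sdiff] at h1 h2
        exact h2.2.2 (e ▸ mono (Nat.succ_le_of_lt hjk) h1.2.1)
      intro j hj k hk e
      simp only [Finset.coe_range, Set.mem_Iio] at hj hk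
      exact le_antisymm (not_lt.1 (this k hk j hj e.symm)) (not_lt.1 (this j hj k hk e))
    have := Finset.card_le_card_of_injOn (s := Finset.range m) (t := X) g
      (fun j hj => by
        have := hg j (by simpa using hj)
        simp only [Finset.mem_inter] at this
        exact this.1) hinj
    rw [Finset.card_range] at this
    omega
  have hX2 : ∀ a ∈ X \ B j, a ∉ B (j + 1) := by
    intro a ha hB'
    rw [Finset.mem_sdiff] at ha
    have : a ∈ X ∩ (B (j + 1) \ B j) := by simp [ha, hB']
    simp [hlayer] at this
  -- The missed layer splits `X` into an inner and an outer part with disjoint neighbourhoods, and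
  -- that of the outer part avoids `R`. The local test for the former and doubling for the latter
  -- together refute the violation.
  have hle1 := hloc (X ∩ B j) (Finset.inter_subset_right.trans (mono hj.le))
    (hX.mono_left Finset.inter_subset_left)
  have hle2 := hexp (X \ B j)
  have hdisj : Disjoint ((X ∩ B j).biUnion N \ R) ((X \ B j).biUnion N) := by
    rw [Finset.disjoint_left]
    intro c hc hc'
    simp only [Finset.mem_sdiff, Finset.mem_biUnion, Finset.mem_inter] at hc
    obtain ⟨a, ha, hca⟩ := Finset.mem_biUnion.1 hc'
    obtain ⟨⟨a', ha', hca'⟩, -⟩ := hc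
    exact hX2 a ha (hN j a' ha'.2 c hca' ((sym a c).1 hca))
  have hsub : ((X ∩ B j).biUnion N \ R) ∪ (X \ B j).biUnion N ⊆ X.biUnion N \ R := by
    intro c hc
    rcases Finset.mem_union.1 hc with hc | hc
    · simp only [Finset.mem_sdiff, Finset.mem_biUnion, Finset.mem_inter] at hc ⊢
      obtain ⟨⟨a, ha, hca⟩, hR⟩ := hc
      exact ⟨⟨a, ha.1, hca⟩, hR⟩
    · obtain ⟨a, ha, hca⟩ := Finset.mem_biUnion.1 hc
      simp only [Finset.mem_sdiff, Finset.mem_biUnion]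
      refine ⟨⟨a, (Finset.mem_sdiff.1 ha).1, hca⟩, fun hR => ?_⟩
      exact hX2 a ha (mono (Nat.zero_le _) (h0 c hR ((sym a c).1 hca)))
  have h1 := Finset.card_le_card hsub
  rw [Finset.card_union_of_disjoint hdisj] at h1
  have h2 := Finset.card_inter_add_card_sdiff X (B j)
  omega

/-- If Hall's condition holds on both sides, then any further vertex can be matched so that Hall's
condition is kept on both sides. -/
theorem HallOutside.exists_extension {N : α → Finset β} {N' : β → Finset α}
    (sym : ∀ a c, c ∈ N a ↔ a ∈ N' c) {D : Finset α} {R : Finset β} (h : HallOutside N D R)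
    (h' : HallOutside N' R D) {a : α} (ha : a ∉ D) :
    ∃ c ∈ N a, c ∉ R ∧ HallOutside N (insert a D) (insert c R) ∧
      HallOutside N' (insert c R) (insert a D) := by
  obtain ⟨f, hf, hfN⟩ := hallOutside_iff_exists_injective.1 h
  obtain ⟨g, hg, hgN⟩ := hallOutside_iff_exists_injective.1 h'
  -- `e` is a perfect matching of the remaining graph: the bijection can be chosen along edges used
  -- by `f` or `g`. The partner of `a` is `e a`, and the rest of `e` proves both new Hall
  -- conditions.
  obtain ⟨e, he, heN⟩ := Function.Embedding.schroeder_bernstein_of_rel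
    (f := fun a => (⟨f a, (hfN a).2⟩ : {c // c ∉ R}))
    (g := fun c => (⟨g c, (hgN c).2⟩ : {a // a ∉ D}))
    (fun x y hxy => hf (congrArg Subtype.val hxy)) (fun x y hxy => hg (congrArg Subtype.val hxy))
    (fun a c => c.1 ∈ N a.1) (fun a => (hfN a).1) (fun c => (sym _ _).2 (hgN c).1)
  refine ⟨e ⟨a, ha⟩, heN _, (e ⟨a, ha⟩).2, hallOutside_iff_exists_injective.2
    ⟨fun x => e ⟨x, fun hx => x.2 (Finset.mem_insert_of_mem hx)⟩, fun x y hxy => ?_, fun x => ?_⟩,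
    hallOutside_iff_exists_injective.2 ?_⟩
  · exact Subtype.ext (Subtype.mk.inj (he.1 (Subtype.ext hxy)))
  · refine ⟨heN _, fun hx => ?_⟩
    rcases Finset.mem_insert.1 hx with hx | hx
    · have := congrArg Subtype.val (he.1 (Subtype.ext hx))
      exact x.2 (this ▸ Finset.mem_insert_self _ _)
    · exact (e _).2 hx
  · choose i hi using he.2
    refine ⟨fun c => i ⟨c, fun hc => c.2 (Finset.mem_insert_of_mem hc)⟩, fun x y hxy => ?_,
      fun c => ⟨?_, fun hx => ?_⟩⟩
    · have := congrArg e (Subtype.ext hxy)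
      rw [hi, hi] at this
      exact Subtype.ext (Subtype.mk.inj this)
    · have := heN (i ⟨c, fun hc => c.2 (Finset.mem_insert_of_mem hc)⟩)
      rw [hi] at this
      exact (sym _ _).1 this
    · rcases Finset.mem_insert.1 hx with hx | hx
      · have : i ⟨c, fun hc => c.2 (Finset.mem_insert_of_mem hc)⟩ = ⟨a, ha⟩ := Subtype.ext hx
        have := congrArg (fun z => (e z).1) this
        simp only [hi] at this
        exact c.2 (Finset.mem_insert.2 (Or.inl this))
      · exact (i _).2 hx

end Hall

/-! ### Extending finite matchings -/

section Matching

/-- Hall's condition for the graph given by the adjacency lists `N`, after removing the vertices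
of the finite matching `M`. -/
def HallAfter (N : ℕ → List ℕ) (M : List (ℕ × ℕ)) : Prop :=
  HallOutside (fun a => (N a).toFinset) (M.map Prod.fst).toFinset (M.map Prod.snd).toFinset

/-- `M` is a finite matching in the graph given by the adjacency lists `N` and `N'`, and Hall's
condition holds on both sides after removing it. -/
structure IsExtendableMatching (N N' : ℕ → List ℕ) (M : List (ℕ × ℕ)) : Prop where
  mem : ∀ p ∈ M, p.2 ∈ N p.1
  fst_eq_iff : ∀ p ∈ M, ∀ q ∈ M, p.1 = q.1 ↔ p.2 = q.2
  left : HallAfter N M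
  right : HallAfter N' (M.map Prod.swap)

theorem IsExtendableMatching.swap {N N' : ℕ → List ℕ} (sym : ∀ a c, c ∈ N a ↔ a ∈ N' c)
    {M : List (ℕ × ℕ)} (h : IsExtendableMatching N N' M) :
    IsExtendableMatching N' N (M.map Prod.swap) where
  mem := by
    simp only [List.mem_map]
    rintro _ ⟨p, hp, rfl⟩
    exact (sym _ _).1 (h.mem p hp)
  fst_eq_iff := by
    simp only [List.mem_map]
    rintro _ ⟨p, hp, rfl⟩ _ ⟨q, hq, rfl⟩
    exact (h.fst_eq_iff p hp q hq).symm
  left := h.right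
  right := by simpa using h.left

open Classical in
/-- Add to `M` an edge at the left vertex `a`, keeping Hall's condition on both sides. -/
noncomputable def extendAt (N N' : ℕ → List ℕ) (a : ℕ) (M : List (ℕ × ℕ)) : List (ℕ × ℕ) :=
  if a ∈ M.map Prod.fst then M else
    (((N a).filter fun c => c ∉ M.map Prod.snd ∧ HallAfter N ((a, c) :: M) ∧
      HallAfter N' (((a, c) :: M).map Prod.swap)).head?).elim M fun c => (a, c) :: M

/-- The filtered list of candidates is nonempty by `HallOutside.exists_extension`, so the default
value in `extendAt` is not reached. -/
theorem IsExtendableMatching.extendAt {N N' : ℕ → List ℕ} (sym : ∀ a c, c ∈ N a ↔ a ∈ N' c)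
    {M : List (ℕ × ℕ)} (h : IsExtendableMatching N N' M) (a : ℕ) :
    IsExtendableMatching N N' (extendAt N N' a M) ∧ M ⊆ _root_.extendAt N N' a M ∧
      a ∈ (_root_.extendAt N N' a M).map Prod.fst := by
  classical
  by_cases ha : a ∈ M.map Prod.fst
  · simp only [_root_.extendAt, if_pos ha]
    exact ⟨h, fun _ hx => hx, ha⟩
  have hr : HallOutside (fun c => (N' c).toFinset) (M.map Prod.snd).toFinset
      (M.map Prod.fst).toFinset := by
    simpa [HallAfter, Function.comp_def] using h.right
  obtain ⟨c, hc, hcR, hl', hr'⟩ := HallOutside.exists_extension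
    (by simpa using sym) h.left hr (a := a) (by simpa using ha)
  have hne : ((N a).filter fun c => decide (c ∉ M.map Prod.snd ∧ HallAfter N ((a, c) :: M) ∧
      HallAfter N' (((a, c) :: M).map Prod.swap))).head? ≠ none := by
    rw [Ne, List.head?_eq_none_iff]
    refine List.ne_nil_of_mem (a := c) (List.mem_filter.2 ⟨by simpa using hc, decide_eq_true ?_⟩)
    refine ⟨by simpa using hcR, ?_, ?_⟩
    · simpa [HallAfter] using hl'
    · simpa [HallAfter, Function.comp_def] using hr'
  obtain ⟨d, hd⟩ := Option.ne_none_iff_exists'.1 hne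
  have hd' := List.mem_filter.1 (List.mem_of_head? hd)
  have hprop := of_decide_eq_true hd'.2
  have heq : _root_.extendAt N N' a M = (a, d) :: M := by
    simp only [_root_.extendAt, if_neg ha, hd, Option.elim_some]
  rw [heq]
  refine ⟨⟨?_, ?_, hprop.2.1, hprop.2.2⟩, List.subset_cons_self _ _, by simp⟩
  · intro p hp
    rcases List.mem_cons.1 hp with rfl | hp
    · exact hd'.1
    · exact h.mem p hp
  · have hfst : ∀ p ∈ M, a ≠ p.1 := fun p hp e => ha (e ▸ List.mem_map_of_mem hp)
    have hsnd : ∀ p ∈ M, d ≠ p.2 := fun p hp e => hprop.1 (e ▸ List.mem_map_of_mem hp)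
    intro p hp q hq
    rcases List.mem_cons.1 hp with rfl | hp <;> rcases List.mem_cons.1 hq with rfl | hq
    · simp
    · simp [hfst q hq, hsnd q hq]
    · simp [(hfst p hp).symm, (hsnd p hp).symm]
    · exact h.fst_eq_iff p hp q hq

/-- The finite matching obtained after treating the first `s` vertices on both sides. -/
noncomputable def stageMatching (N N' : ℕ → List ℕ) (s : ℕ) : List (ℕ × ℕ) :=
  Nat.rec [] (fun a M => (extendAt N' N a ((extendAt N N' a M).map Prod.swap)).map Prod.swap) s

/-- Step `s` treats left vertex `s` and then right vertex `s`, and edges are never removed. The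
union is thus a perfect matching, and the partner of `a` can be read off already at stage `a + 1`.
-/
theorem exists_bijective_of_isExtendableMatching_nil {N N' : ℕ → List ℕ}
    (sym : ∀ a c, c ∈ N a ↔ a ∈ N' c) (h : IsExtendableMatching N N' []) :
    ∃ f : ℕ → ℕ, Function.Bijective f ∧ (∀ a, f a ∈ N a) ∧
      ∀ a c, (a, c) ∈ stageMatching N N' (a + 1) ↔ f a = c := by
  have step : ∀ s, IsExtendableMatching N N' (stageMatching N N' s) →
      IsExtendableMatching N N' (stageMatching N N' (s + 1)) ∧
      stageMatching N N' s ⊆ stageMatching N N' (s + 1) ∧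
      (∃ c, (s, c) ∈ stageMatching N N' (s + 1)) ∧
      ∃ a, (a, s) ∈ stageMatching N N' (s + 1) := by
    intro s hs
    obtain ⟨h1, h2, h3⟩ := hs.extendAt sym s
    obtain ⟨h4, h5, h6⟩ := (h1.swap sym).extendAt (fun a c => (sym c a).symm) s
    have h7 : ∀ p ∈ extendAt N N' s (stageMatching N N' s), p ∈ stageMatching N N' (s + 1) :=
      fun p hp => List.mem_map.2 ⟨p.swap, h5 (List.mem_map_of_mem hp), Prod.swap_swap p⟩
    refine ⟨h4.swap (fun a c => (sym c a).symm), fun p hp => h7 p (h2 hp), ?_, ?_⟩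
    · obtain ⟨p, hp, rfl⟩ := List.mem_map.1 h3
      exact ⟨p.2, h7 _ hp⟩
    · obtain ⟨p, hp, e⟩ := List.mem_map.1 h6
      exact ⟨p.2, List.mem_map.2 ⟨p, hp, Prod.ext rfl e⟩⟩
  have ext : ∀ s, IsExtendableMatching N N' (stageMatching N N' s) := fun s => by
    induction s with
    | zero => exact h
    | succ s ih => exact (step s ih).1
  have mono : ∀ s t, s ≤ t → stageMatching N N' s ⊆ stageMatching N N' t := fun s t hst => by
    induction t, hst using Nat.le_induction with
    | base => exact fun _ hx => hx
    | succ t _ ih => exact fun _ hx => (step t (ext t)).2.1 (ih hx)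
  have compat : ∀ s t p q, p ∈ stageMatching N N' s → q ∈ stageMatching N N' t →
      (p.1 = q.1 ↔ p.2 = q.2) := fun s t p q hp hq =>
    (ext (max s t)).fst_eq_iff p (mono _ _ (le_max_left _ _) hp) q (mono _ _ (le_max_right _ _) hq)
  choose f hf using fun s => (step s (ext s)).2.2.1
  choose g hg using fun s => (step s (ext s)).2.2.2
  refine ⟨f, ⟨fun a b hab => (compat _ _ _ _ (hf a) (hf b)).2 hab, fun c => ⟨g c, ?_⟩⟩,
    fun a => (ext _).mem _ (hf a), fun a c => ⟨fun hc => ?_, ?_⟩⟩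
  · exact (compat _ _ _ _ (hf (g c)) (hg c)).1 rfl
  · exact (compat _ _ _ _ (hf a) hc).1 rfl
  · rintro rfl
    exact hf a

end Matching

/-! ### Uniformly computable perfect matchings -/

section UniformMatching

variable {ι Γ : Type*} [Primcodable Γ] {π : ι → Γ} {N N' : ι → ℕ → List ℕ}

open UnifComputable

theorem UnifComputable.list_filter {α β : Type*} [Primcodable α] [Primcodable β]
    {l : ι → α → List β} {p : ι → α → β → Bool} (hl : UnifComputable π l)
    (hp : UnifComputable π fun i (x : α × β) => p i x.1 x.2) :
    UnifComputable π fun i a => (l i a).filter (p i a) := by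
  refine (list_flatMap (f := fun i a b => bif p i a b then [b] else []) hl
    (cond hp (list_cons snd (const [])) (const []))).of_eq fun i a => ?_
  induction l i a with
  | nil => rfl
  | cons b t ih =>
    rw [List.flatMap_cons, ih, List.filter_cons]
    cases p i a b <;> rfl

theorem unifDecidable_nodup : UnifDecidable π fun _ (l : List ℕ) => l.Nodup := by
  have hrange : UnifComputable π fun _ (l : List ℕ) => List.range l.length :=
    of_computable (Computable.comp Primrec.list_range.to_comp Computable.list_length)
  have hget : UnifComputable π fun _ (x : List ℕ × ℕ) => x.1[x.2]? :=
    of_computable Computable.list_getElem?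
  have h := UnifDecidable.forall_mem_list (π := π)
    (P := fun _ (l : List ℕ) p => ∀ q ∈ List.range l.length, ¬ l[p]? = l[q]? ∨ p = q) hrange
    (UnifDecidable.forall_mem_list
      (P := fun _ (x : List ℕ × ℕ) q => ¬ x.1[x.2]? = x.1[q]? ∨ x.2 = q) (hrange.comp fst)
      (((UnifDecidable.eq (hget.comp fst) (hget.comp ((fst.comp fst).pair snd))).not).or
        (UnifDecidable.eq (snd.comp fst) snd)))
  refine h.of_iff fun _ l => ?_
  rw [List.nodup_iff_getElem?_ne_getElem?]
  simp only [List.mem_range]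
  constructor
  · intro h p q hpq hq e
    rcases h p (hpq.trans hq) q hq with h | h
    · exact h e
    · exact hpq.ne h
  · intro h p hp q hq
    by_contra hne
    push Not at hne
    rcases lt_or_gt_of_ne hne.2 with hlt | hlt
    · exact h p q hlt hq hne.1
    · exact h q p hlt hp hne.1.symm

/-! ### Deciding Hall's condition after a finite matching. -/

/-- A list whose elements include the left vertices at distance at most `2 * j + 1` from the right
vertices in `R`. -/
def ballList (N N' : ℕ → List ℕ) (R : List ℕ) (j : ℕ) : List ℕ :=
  Nat.rec (R.flatMap N') (fun _ B => B ++ B.flatMap fun a => (N a).flatMap N') j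

theorem unifComputable_ballList (hN : UnifComputable π N) (hN' : UnifComputable π N') :
    UnifComputable π fun i (x : List ℕ × ℕ) => ballList (N i) (N' i) x.1 x.2 := by
  refine nat_rec snd (list_flatMap fst (hN'.comp snd)) ?_
  refine (of_computable Computable.list_append).comp ((snd.comp snd).pair
    (list_flatMap (f := fun i _ a => (N i a).flatMap (N' i)) (snd.comp snd)
      (list_flatMap (hN.comp snd) (hN'.comp snd))))

/-- The witness `W` matches the unmatched vertices of one finite ball, which suffices by
`HallOutside.of_ball`. `W` may give a left vertex several partners, since any choice among them is
injective. -/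
theorem hallAfter_iff_exists_matching {N N' : ℕ → List ℕ} (sym : ∀ a c, c ∈ N a ↔ a ∈ N' c)
    (hexp : ∀ X : Finset ℕ, 2 * X.card ≤ (X.biUnion fun a => (N a).toFinset).card)
    (M : List (ℕ × ℕ)) :
    HallAfter N M ↔ ∃ W : List (ℕ × ℕ), (∀ p ∈ W, p.2 ∈ N p.1 ∧ p.2 ∉ M.map Prod.snd) ∧
      (∀ p ∈ W, ∀ q ∈ W, ¬ p.2 = q.2 ∨ p.1 = q.1) ∧
      ∀ a ∈ ballList N N' (M.map Prod.snd) M.length, a ∈ M.map Prod.fst ∨ a ∈ W.map Prod.fst := by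
  classical
  constructor
  · intro h
    obtain ⟨f, hf, hfN⟩ := hallOutside_iff_exists_injective.1 h
    refine ⟨(ballList N N' (M.map Prod.snd) M.length).flatMap fun a =>
      if ha : a ∈ (M.map Prod.fst).toFinset then [] else [(a, f ⟨a, ha⟩)], ?_, ?_, ?_⟩
    · intro p hp
      obtain ⟨a, -, hp⟩ := List.mem_flatMap.1 hp
      split_ifs at hp with ha
      · simp at hp
      · obtain rfl := List.mem_singleton.1 hp
        have := hfN ⟨a, ha⟩
        simpa only [List.mem_toFinset] using this
    · intro p hp q hq
      obtain ⟨a, -, hp⟩ := List.mem_flatMap.1 hp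
      obtain ⟨b, -, hq⟩ := List.mem_flatMap.1 hq
      split_ifs at hp with ha
      · simp at hp
      split_ifs at hq with hb
      · simp at hq
      obtain rfl := List.mem_singleton.1 hp
      obtain rfl := List.mem_singleton.1 hq
      by_cases e : f ⟨a, ha⟩ = f ⟨b, hb⟩
      · exact Or.inr (Subtype.mk.inj (hf e))
      · exact Or.inl e
    · intro a ha
      by_cases haD : a ∈ M.map Prod.fst
      · exact Or.inl haD
      · right
        have haD' : a ∉ (M.map Prod.fst).toFinset := by rwa [List.mem_toFinset]
        refine List.mem_map.2 ⟨(a, f ⟨a, haD'⟩), List.mem_flatMap.2 ⟨a, ha, ?_⟩, rfl⟩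
        rw [dif_neg haD']
        exact List.mem_singleton_self _
  · rintro ⟨W, hW, hinj, hcov⟩
    refine HallOutside.of_ball (N' := fun c => (N' c).toFinset)
      (B := fun j => (ballList N N' (M.map Prod.snd) j).toFinset) (m := M.length)
      (by simpa using sym) hexp ?_ ?_ ?_ ?_ ?_
    · intro c hc a ha
      rw [List.mem_toFinset] at hc ha ⊢
      exact List.mem_flatMap.2 ⟨c, hc, ha⟩
    · intro j a ha
      rw [List.mem_toFinset] at ha ⊢
      exact List.mem_append_left _ ha
    · intro j a ha c hc b hb
      rw [List.mem_toFinset] at ha hc hb ⊢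
      exact List.mem_append_right _
        (List.mem_flatMap.2 ⟨a, ha, List.mem_flatMap.2 ⟨c, hc, hb⟩⟩)
    · exact (List.toFinset_card_le _).trans (by simp)
    · intro X hXB hXD
      have hex : ∀ a ∈ X, ∃ c, (a, c) ∈ W := by
        intro a ha
        have h1 : a ∉ M.map Prod.fst := by
          rw [← List.mem_toFinset]
          exact Finset.disjoint_left.1 hXD ha
        obtain ⟨p, hp, rfl⟩ :=
          List.mem_map.1 ((hcov a (List.mem_toFinset.1 (hXB ha))).resolve_left h1)
        exact ⟨p.2, hp⟩
      choose! g hg using hex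
      refine Finset.card_le_card_of_injOn g (fun a ha => ?_) fun a ha b hb e => ?_
      · have := hW _ (hg a ha)
        simp only [Finset.coe_sdiff, Set.mem_sdiff, SetLike.mem_coe, Finset.mem_biUnion,
          List.mem_toFinset]
        exact ⟨⟨a, ha, this.1⟩, this.2⟩
      · exact (hinj _ (hg a ha) _ (hg b hb)).resolve_left fun h => h e

/-- The second list covers the surviving neighbours of the violating set, so checking a witness
needs only bounded quantifiers and lengths. -/
theorem not_hallAfter_iff_exists_violation (N : ℕ → List ℕ) (M : List (ℕ × ℕ)) :
    ¬ HallAfter N M ↔ ∃ w : List ℕ × List ℕ, w.1.Nodup ∧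
      (∀ a ∈ w.1, a ∉ M.map Prod.fst ∧ ∀ c ∈ N a, c ∈ M.map Prod.snd ∨ c ∈ w.2) ∧
      w.2.length < w.1.length := by
  simp only [HallAfter, HallOutside]
  push Not
  constructor
  · rintro ⟨X, hX, hlt⟩
    refine ⟨(X.toList, (X.biUnion (fun a => (N a).toFinset) \ (M.map Prod.snd).toFinset).toList),
      Finset.nodup_toList _, fun a ha => ⟨?_, fun c hc => ?_⟩, by simpa using hlt⟩
    · rw [← List.mem_toFinset]
      exact Finset.disjoint_left.1 hX (Finset.mem_toList.1 ha)
    · by_cases hR : c ∈ M.map Prod.snd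
      · exact Or.inl hR
      · refine Or.inr (Finset.mem_toList.2 ?_)
        rw [Finset.mem_sdiff, Finset.mem_biUnion, List.mem_toFinset]
        exact ⟨⟨a, Finset.mem_toList.1 ha, List.mem_toFinset.2 hc⟩, hR⟩
  · rintro ⟨⟨X, Y⟩, hnodup, hX, hlt⟩
    refine ⟨X.toFinset, ?_, ?_⟩
    · rw [Finset.disjoint_left]
      intro a ha
      rw [List.mem_toFinset] at ha ⊢
      exact (hX a ha).1
    · rw [List.toFinset_card_of_nodup hnodup]
      refine (Finset.card_le_card (t := Y.toFinset) fun c hc => ?_).trans_lt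
        ((List.toFinset_card_le Y).trans_lt hlt)
      simp only [Finset.mem_sdiff, Finset.mem_biUnion, List.mem_toFinset] at hc ⊢
      obtain ⟨⟨a, ha, hc⟩, hR⟩ := hc
      exact ((hX a ha).2 c hc).resolve_left hR

theorem unifDecidable_hallAfter (hN : UnifComputable π N) (hN' : UnifComputable π N')
    (sym : ∀ i a c, c ∈ N i a ↔ a ∈ N' i c)
    (hexp : ∀ i (X : Finset ℕ), 2 * X.card ≤ (X.biUnion fun a => (N i a).toFinset).card) :
    UnifDecidable π fun i M => HallAfter (N i) M := by
  have hfst : UnifComputable π fun _ (M : List (ℕ × ℕ)) => M.map Prod.fst :=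
    list_map (f := fun _ _ (p : ℕ × ℕ) => p.1) UnifComputable.id (fst.comp snd)
  have hsnd : UnifComputable π fun _ (M : List (ℕ × ℕ)) => M.map Prod.snd :=
    list_map (f := fun _ _ (p : ℕ × ℕ) => p.2) UnifComputable.id (snd.comp snd)
  have hlen : ∀ {α : Type} [Primcodable α], UnifComputable π fun _ (l : List α) => l.length :=
    of_computable Computable.list_length
  refine UnifDecidable.of_witnesses (β := List (ℕ × ℕ)) (γ := List ℕ × List ℕ) ?_ ?_
    (fun i => hallAfter_iff_exists_matching (sym i) (hexp i))
    (fun i => not_hallAfter_iff_exists_violation (N i))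
  · refine .and ?_ (.and ?_ ?_)
    · exact UnifDecidable.forall_mem_list
        (P := fun i (x : List (ℕ × ℕ) × List (ℕ × ℕ)) (p : ℕ × ℕ) => p.2 ∈ N i p.1 ∧ p.2 ∉ x.1.map Prod.snd)
        snd ((UnifDecidable.mem_list (snd.comp snd) (hN.comp (fst.comp snd))).and
          (UnifDecidable.mem_list (snd.comp snd) (hsnd.comp (fst.comp fst))).not)
    · exact UnifDecidable.forall_mem_list
        (P := fun _ (x : List (ℕ × ℕ) × List (ℕ × ℕ)) (p : ℕ × ℕ) => ∀ q ∈ x.2, ¬ p.2 = q.2 ∨ p.1 = q.1)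
        snd (UnifDecidable.forall_mem_list
          (P := fun _ (y : (List (ℕ × ℕ) × List (ℕ × ℕ)) × ℕ × ℕ) (q : ℕ × ℕ) =>
            ¬ y.2.2 = q.2 ∨ y.2.1 = q.1) (snd.comp fst)
          ((UnifDecidable.eq (snd.comp (snd.comp fst)) (snd.comp snd)).not.or
            (UnifDecidable.eq (fst.comp (snd.comp fst)) (fst.comp snd))))
    · exact UnifDecidable.forall_mem_list
        (P := fun _ (x : List (ℕ × ℕ) × List (ℕ × ℕ)) a =>
          a ∈ x.1.map Prod.fst ∨ a ∈ x.2.map Prod.fst)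
        ((unifComputable_ballList hN hN').comp ((hsnd.comp fst).pair (hlen.comp fst)))
        ((UnifDecidable.mem_list snd (hfst.comp (fst.comp fst))).or
          (UnifDecidable.mem_list snd (hfst.comp (snd.comp fst))))
  · refine .and (unifDecidable_nodup.comp (fst.comp snd)) (.and ?_ ?_)
    · exact UnifDecidable.forall_mem_list
        (P := fun i (x : List (ℕ × ℕ) × List ℕ × List ℕ) a => a ∉ x.1.map Prod.fst ∧
          ∀ c ∈ N i a, c ∈ x.1.map Prod.snd ∨ c ∈ x.2.2) (fst.comp snd)
        ((UnifDecidable.mem_list snd (hfst.comp (fst.comp fst))).not.and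
          (UnifDecidable.forall_mem_list
            (P := fun _ (y : (List (ℕ × ℕ) × List ℕ × List ℕ) × ℕ) c =>
              c ∈ y.1.1.map Prod.snd ∨ c ∈ y.1.2.2) (hN.comp snd)
            ((UnifDecidable.mem_list snd (hsnd.comp (fst.comp (fst.comp fst)))).or
              (UnifDecidable.mem_list snd (snd.comp (snd.comp (fst.comp fst)))))))
    · exact (UnifDecidable.of_primrecPred Primrec.nat_lt).comp
        ((hlen.comp (snd.comp snd)).pair (hlen.comp (fst.comp snd)))

/-! ### Computing the stages and the limit matching. -/

theorem unifComputable_map_swap :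
    UnifComputable π fun _ (M : List (ℕ × ℕ)) => M.map Prod.swap :=
  list_map (f := fun _ _ (p : ℕ × ℕ) => p.swap) UnifComputable.id ((snd.comp snd).pair (fst.comp snd))

theorem unifComputable_extendAt (hN : UnifComputable π N)
    (hH : UnifDecidable π fun i M => HallAfter (N i) M)
    (hH' : UnifDecidable π fun i M => HallAfter (N' i) M) :
    UnifComputable π fun i (x : ℕ × List (ℕ × ℕ)) => extendAt (N i) (N' i) x.1 x.2 := by
  classical
  have hcons : UnifComputable π fun _ (y : (ℕ × List (ℕ × ℕ)) × ℕ) => (y.1.1, y.2) :: y.1.2 :=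
    list_cons ((fst.comp fst).pair snd) (snd.comp fst)
  refine (ite (f := fun _ x => x.2)
    (g := fun i x => (((N i x.1).filter fun c => decide (c ∉ x.2.map Prod.snd ∧
      HallAfter (N i) ((x.1, c) :: x.2) ∧
      HallAfter (N' i) (((x.1, c) :: x.2).map Prod.swap))).head?).elim x.2 fun c =>
        (x.1, c) :: x.2)
    (UnifDecidable.mem_list fst
      (list_map (f := fun _ _ (p : ℕ × ℕ) => p.1) snd (fst.comp snd))) snd ?_).of_eq
    fun i x => by unfold extendAt; congr
  refine option_casesOn ?_ snd hcons
  refine (of_computable Primrec.list_head?.to_comp).comp (list_filter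
    (p := fun i (x : ℕ × List (ℕ × ℕ)) c => decide (c ∉ x.2.map Prod.snd ∧
      HallAfter (N i) ((x.1, c) :: x.2) ∧ HallAfter (N' i) (((x.1, c) :: x.2).map Prod.swap)))
    (hN.comp fst) ?_)
  have hmem : UnifDecidable π fun _ (y : (ℕ × List (ℕ × ℕ)) × ℕ) => y.2 ∉ y.1.2.map Prod.snd :=
    (UnifDecidable.mem_list snd
      (list_map (f := fun _ _ (p : ℕ × ℕ) => p.2) (snd.comp fst) (snd.comp snd))).not
  exact UnifComputable.of_eq (hmem.and ((hH.comp hcons).and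
    (hH'.comp (unifComputable_map_swap.comp hcons)))) fun i y => by congr

/-- **Effective Hall theorem.** If in a bipartite graph on two copies of `ℕ`, given by uniformly
computable adjacency lists, all finite sets of vertices at least double, then there is a uniformly
computable perfect matching. -/
theorem exists_unifComputable_bijective (hN : UnifComputable π N) (hN' : UnifComputable π N')
    (sym : ∀ i a c, c ∈ N i a ↔ a ∈ N' i c)
    (hexp : ∀ i (X : Finset ℕ), 2 * X.card ≤ (X.biUnion fun a => (N i a).toFinset).card)
    (hexp' : ∀ i (Y : Finset ℕ), 2 * Y.card ≤ (Y.biUnion fun c => (N' i c).toFinset).card) :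
    ∃ f : ι → ℕ → ℕ, UnifComputable π f ∧
      ∀ i, Function.Bijective (f i) ∧ ∀ a, f i a ∈ N i a := by
  have sym' : ∀ i c a, a ∈ N' i c ↔ c ∈ N i a := fun i c a => (sym i a c).symm
  have hH := unifDecidable_hallAfter hN hN' sym hexp
  have hH' := unifDecidable_hallAfter hN' hN sym' hexp'
  have hE := unifComputable_extendAt hN hH hH'
  have hE' := unifComputable_extendAt hN' hH' hH
  have hstage : UnifComputable π fun i s => stageMatching (N i) (N' i) s := by
    refine nat_rec UnifComputable.id (const []) ?_
    have ha : UnifComputable π fun _ (x : ℕ × ℕ × List (ℕ × ℕ)) => x.2.1 := fst.comp snd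
    exact unifComputable_map_swap.comp (hE'.comp
      (ha.pair (unifComputable_map_swap.comp (hE.comp (ha.pair (snd.comp snd))))))
  have nil : ∀ i, IsExtendableMatching (N i) (N' i) [] := fun i => by
    refine ⟨by simp, by simp, fun X _ => ?_, fun Y _ => ?_⟩
    · have := hexp i X
      simp only [List.map_nil, List.toFinset_nil, Finset.sdiff_empty]
      omega
    · have := hexp' i Y
      simp only [List.map_nil, List.toFinset_nil, Finset.sdiff_empty]
      omega
  choose f hf hfN hfs using fun i => exists_bijective_of_isExtendableMatching_nil (sym i) (nil i)
  refine ⟨f, ?_, fun i => ⟨hf i, hfN i⟩⟩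
  have hP : UnifDecidable π fun i (x : ℕ × ℕ) => x ∈ stageMatching (N i) (N' i) (x.1 + 1) :=
    UnifDecidable.mem_list UnifComputable.id
      (hstage.comp ((of_computable Computable.succ).comp fst))
  refine (sInf (P := fun i a c => (a, c) ∈ stageMatching (N i) (N' i) (a + 1)) hP
    fun i a => ⟨f i a, (hfs i a _).2 rfl⟩).of_eq fun i a => ?_
  simp only [hfs]
  exact csInf_singleton (f i a) ▸ congrArg _ (by ext; simp [eq_comm])

end UniformMatching

/-! ### Programs from uniformly decidable predicates -/

section Programs

open Nat.Partrec (Code)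

theorem exists_code_of_partrec {α σ : Type*} [Primcodable α] [Primcodable σ] {f : α →. σ}
    (hf : Partrec f) : ∃ c : Code, ∀ a, c.eval (Encodable.encode a) = (f a).map Encodable.encode := by
  obtain ⟨c, hc⟩ := Code.exists_code.1 hf
  exact ⟨c, fun a => by simp [hc]⟩

theorem ComputablePred.exists_decides {α : Type*} [Primcodable α] {p : α → Prop}
    (hp : ComputablePred p) : ∃ c : Code, Decides c p := by
  obtain ⟨_, hp⟩ := hp
  obtain ⟨c, hc⟩ := exists_code_of_partrec hp.partrec
  exact ⟨c, fun a => ⟨fun h => by simp [hc, h], fun h => by simp [hc, h]⟩⟩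

/-- The s-m-n theorem: currying one program for the whole family yields the individual programs
computably. -/
theorem UnifDecidable.exists_decides {ι Γ α β : Type*} [Primcodable Γ] [Primcodable α]
    [Primcodable β] {π : ι → Γ} {P : ι → α → β → Prop}
    (hP : UnifDecidable π fun i (x : α × β) => P i x.1 x.2) :
    ∃ C : Γ → α → Code, (UnifComputable π fun i a => C (π i) a) ∧
      ∀ i a, Decides (C (π i) a) (P i a) := by
  obtain ⟨F, hF, hF'⟩ := hP
  obtain ⟨c, hc⟩ := exists_code_of_partrec (f := fun x : (Γ × α) × β => F (x.1.1, x.1.2, x.2))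
    (hF.comp ((Computable.fst.comp Computable.fst).pair
      ((Computable.snd.comp Computable.fst).pair Computable.snd)))
  refine ⟨fun γ a => Code.curry c (Encodable.encode (γ, a)),
    ⟨fun x => Part.some (Code.curry c (Encodable.encode x)), ?_, fun _ _ => rfl⟩, fun i a b => ?_⟩
  · exact (Code.primrec₂_curry.comp (Primrec.const c) Primrec.encode).to_comp.partrec
  · have : (Code.curry c (Encodable.encode (π i, a))).eval (Encodable.encode b) =
        Part.some (Encodable.encode (@decide (P i a b) (Classical.propDecidable _))) := by
      rw [Code.eval_curry]
      have := hc ((π i, a), b)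
      rw [hF', Part.map_some] at this
      exact this
    rw [this]
    exact ⟨fun h => by simp [h], fun h => by simp [h]⟩

end Programs

/-! ### Expansion and paradoxical decompositions in groups -/

section Group

variable {G : Type*} [Group G]

theorem FailsFolner.mono {K₀ K₁ : Finset G} {n : ℕ} (h : FailsFolner K₀ n) (hK : K₀ ⊆ K₁) :
    FailsFolner K₁ n :=
  ⟨h.1, fun F hF => (h.2 F hF).imp fun _ hk => ⟨hK hk.1, hk.2⟩⟩

/-- If `G` were finite, `F = G` would give `F \ kF = ∅`. -/
theorem FailsFolner.infinite {K₀ : Finset G} {n : ℕ} (h : FailsFolner K₀ n) : Infinite G := by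
  classical
  by_contra hfin
  have := @Fintype.ofFinite G (not_infinite_iff_finite.1 hfin)
  obtain ⟨k, -, hk⟩ := h.2 Finset.univ ⟨1, Finset.mem_univ _⟩
  have hn : (0 : ℝ) < 1 / n := one_div_pos.2 (by exact_mod_cast h.1)
  have h0 : Finset.univ \ (k • (Finset.univ : Finset G)) = ∅ := by
    rw [Finset.smul_finset_univ, Finset.sdiff_self]
  have : (1 : ℝ) / n ≤ 0 := by
    refine hk.trans (le_of_eq ?_)
    rw [div_eq_zero_iff]
    left
    rw [Nat.cast_eq_zero, Finset.card_eq_zero]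
    convert h0
  linarith

/-- For the `k` supplied for `F`, the product set contains the disjoint sets `F \ kF` and `kF`, the
latter of size `|F|`. -/
theorem FailsFolner.card_mul [DecidableEq G] {K₀ : Finset G} {n : ℕ} (h : FailsFolner K₀ n)
    (F : Finset G) : (1 + 1 / n : ℝ) * F.card ≤ (insert 1 K₀ * F).card := by
  rcases F.eq_empty_or_nonempty with rfl | hF
  · simp
  obtain ⟨k, hk, hkF⟩ := h.2 F hF
  have hpos : (0 : ℝ) < F.card := by exact_mod_cast hF.card_pos
  rw [le_div_iff₀ hpos] at hkF
  have hsub : (F \ (k • F)) ∪ k • F ⊆ insert 1 K₀ * F := by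
    intro x hx
    rcases Finset.mem_union.1 hx with hx | hx
    · exact Finset.mem_mul.2 ⟨1, Finset.mem_insert_self _ _, x, (Finset.mem_sdiff.1 hx).1,
        one_mul x⟩
    · obtain ⟨y, hy, rfl⟩ := Finset.mem_smul_finset.1 hx
      exact Finset.mul_mem_mul (Finset.mem_insert_of_mem hk) hy
  have hc := Finset.card_le_card hsub
  rw [Finset.card_union_of_disjoint Finset.sdiff_disjoint, Finset.card_smul_finset] at hc
  have hc' : ((F \ (k • F)).card : ℝ) + F.card ≤ (insert 1 K₀ * F).card := by
    exact_mod_cast hc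
  have hkF' : (1 : ℝ) / n * F.card ≤ (F \ (k • F)).card := by
    refine hkF.trans (le_of_eq ?_)
    congr!
  linarith

theorem FailsFolner.card_pow_mul [DecidableEq G] {K₀ : Finset G} {n : ℕ} (h : FailsFolner K₀ n)
    (F : Finset G) (m : ℕ) :
    (1 + 1 / n : ℝ) ^ m * F.card ≤ ((insert 1 K₀) ^ m * F).card := by
  induction m with
  | zero => simp
  | succ m ih =>
    have h1 := h.card_mul ((insert 1 K₀) ^ m * F)
    rw [← mul_assoc, ← pow_succ'] at h1
    refine le_trans ?_ h1
    rw [pow_succ', mul_assoc]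
    exact mul_le_mul_of_nonneg_left ih (by positivity)

theorem FailsFolner.four_mul_card_le [DecidableEq G] {K₀ : Finset G} {n : ℕ}
    (h : FailsFolner K₀ n) (F : Finset G) :
    4 * F.card ≤ ((insert 1 K₀) ^ (2 * n) * F).card := by
  have h1 := h.card_pow_mul F (2 * n)
  have hn : (n : ℝ) ≠ 0 := by exact_mod_cast h.1.ne'
  -- Bernoulli's inequality; squaring it explains the exponent `2 * n`.
  have h2 : (2 : ℝ) ≤ (1 + 1 / n : ℝ) ^ n := by
    have hb := one_add_mul_le_pow (a := (1 / n : ℝ))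
      (by have : (0 : ℝ) ≤ 1 / n := by positivity
          linarith) n
    rw [mul_one_div_cancel hn] at hb
    linarith
  have h3 : (4 : ℝ) ≤ (1 + 1 / n : ℝ) ^ (2 * n) := by
    rw [mul_comm, pow_mul]
    nlinarith
  have h4 : (4 : ℝ) * F.card ≤ ((insert 1 K₀) ^ (2 * n) * F).card :=
    (mul_le_mul_of_nonneg_right h3 (Nat.cast_nonneg _)).trans h1
  exact_mod_cast h4

/-- Since `k = φ x * x⁻¹` is determined by `x`, the pieces are disjoint; their translates are their
images under `φ`, disjoint by injectivity. The same holds for `ψ`. -/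
theorem isParadoxicalDecomposition_of_injective {K : Finset G} {φ ψ : G → G}
    (hφ : Function.Injective φ) (hψ : Function.Injective ψ) (hne : ∀ x y, φ x ≠ ψ y)
    (hsurj : ∀ z, (∃ x, φ x = z) ∨ ∃ x, ψ x = z) (hφK : ∀ x, ∃ k ∈ K, k * x = φ x)
    (hψK : ∀ x, ∃ k ∈ K, k * x = ψ x) :
    IsParadoxicalDecomposition K (fun k => {x | k * x = φ x}) (fun k => {x | k * x = ψ x}) := by
  have disj : ∀ χ : G → G, (K : Set G).PairwiseDisjoint fun k => {x | k * x = χ x} := by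
    intro χ k _ k' _ hkk'
    refine Set.disjoint_left.2 fun x hx hx' => hkk' ?_
    exact mul_right_cancel (hx.trans (Eq.symm hx'))
  have disj_smul : ∀ χ : G → G, Function.Injective χ →
      (K : Set G).PairwiseDisjoint fun k => k • {x | k * x = χ x} := by
    intro χ hχ k _ k' _ hkk'
    refine Set.disjoint_left.2 fun z hz hz' => hkk' ?_
    obtain ⟨x, hx, rfl⟩ := hz
    obtain ⟨y, hy, hxy⟩ := hz'
    have hx' : k * x = χ x := hx
    have hy' : k' * y = χ y := hy
    have e : k' * y = k * x := hxy
    obtain rfl : y = x := hχ (by rw [← hx', ← hy', e])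
    exact (mul_right_cancel e).symm
  have union : ∀ χ : G → G, (∀ x, ∃ k ∈ K, k * x = χ x) →
      ⋃ k ∈ K, {x | k * x = χ x} = Set.univ := by
    intro χ hχ
    refine Set.eq_univ_of_forall fun x => ?_
    simpa using hχ x
  have union_smul : ∀ χ : G → G, (∀ x, ∃ k ∈ K, k * x = χ x) →
      ⋃ k ∈ K, k • {x | k * x = χ x} = Set.range χ := by
    intro χ hχ
    ext z
    simp only [Set.mem_iUnion, Set.mem_range]
    constructor
    · rintro ⟨k, _, x, hx, rfl⟩
      exact ⟨x, Eq.symm hx⟩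
    · rintro ⟨x, rfl⟩
      obtain ⟨k, hk, hx⟩ := hχ x
      exact ⟨k, hk, x, hx, hx⟩
  refine ⟨disj φ, union φ hφK, disj ψ, union ψ hψK, disj_smul φ hφ, disj_smul ψ hψ, ?_, ?_⟩
  · rw [union_smul φ hφK, union_smul ψ hψK, Set.disjoint_left]
    rintro _ ⟨x, rfl⟩ ⟨y, hy⟩
    exact hne x y hy.symm
  · rw [union_smul φ hφK, union_smul ψ hψK]
    exact Set.eq_univ_of_forall hsurj

end Group

/-! ### The effective paradoxical decomposition -/

/-- A computable group with a program `e` for its multiplication table, together with a finite set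
`K₀`, given by a list `l`, and a number `n` witnessing that the Følner condition fails. -/
structure NonFolnerInput where
  G : Type u
  [group : Group G]
  ν : ℕ → G
  e : Nat.Partrec.Code
  l : List ℕ
  n : ℕ
  K₀ : Finset G
  surjective : Function.Surjective ν
  decides : Decides e (MultT ν)
  isListOf : IsListOf ν l K₀
  failsFolner : FailsFolner K₀ n

namespace NonFolnerInput

attribute [instance] NonFolnerInput.group

open UnifComputable

/-- The data on which an algorithm may operate. -/
def data (I : NonFolnerInput.{u}) : Nat.Partrec.Code × List ℕ × ℕ := (I.e, I.l, I.n)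

variable {α : Type*} [Primcodable α]

theorem unifDecidable_multT : UnifDecidable data fun I : NonFolnerInput.{u} => MultT I.ν := by
  refine ⟨fun x => (x.1.1.eval (Encodable.encode x.2)).map fun k => decide (k = 1), ?_,
    fun I t => ?_⟩
  · refine Partrec.map (Nat.Partrec.Code.eval_part.comp (Computable.fst.comp Computable.fst)
      (Computable.encode.comp Computable.snd)) ?_
    exact (Primrec.eq.decide.comp Primrec.snd (Primrec.const 1)).to_comp
  · rw [Part.eq_some_iff, Part.mem_map_iff]
    by_cases h : MultT I.ν t
    · exact ⟨1, (I.decides t).1 h, by simp [h]⟩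
    · exact ⟨0, (I.decides t).2 h, by simp [h]⟩

theorem unifDecidable_mul_eq {f g h : NonFolnerInput.{u} → α → ℕ} (hf : UnifComputable data f)
    (hg : UnifComputable data g) (hh : UnifComputable data h) :
    UnifDecidable data fun I a => I.ν (f I a) * I.ν (g I a) = I.ν (h I a) :=
  unifDecidable_multT.comp (hf.pair (hg.pair hh))

/-! ### Computing in the group through numbers. -/

/-- A number of the unit. -/
noncomputable def one (I : NonFolnerInput.{u}) : ℕ := sInf {i | I.ν i * I.ν i = I.ν i}

theorem exists_mul_self (I : NonFolnerInput.{u}) : ∃ i, I.ν i * I.ν i = I.ν i :=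
  (I.surjective 1).imp fun i hi => by simp [hi]

theorem ν_one (I : NonFolnerInput.{u}) : I.ν I.one = 1 :=
  mul_eq_left.1 (Nat.sInf_mem I.exists_mul_self)

theorem unifComputable_one : UnifComputable data fun (I : NonFolnerInput.{u}) (_ : α) => I.one :=
  sInf (P := fun (I : NonFolnerInput.{u}) _ i => I.ν i * I.ν i = I.ν i) (unifDecidable_mul_eq snd snd snd)
    fun I _ => I.exists_mul_self

/-- A number of the product of the elements with numbers `i` and `j`. -/
noncomputable def mul (I : NonFolnerInput.{u}) (i j : ℕ) : ℕ := sInf {k | I.ν i * I.ν j = I.ν k}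

theorem exists_mul (I : NonFolnerInput.{u}) (i j : ℕ) : ∃ k, I.ν i * I.ν j = I.ν k :=
  (I.surjective _).imp fun _ h => h.symm

theorem ν_mul (I : NonFolnerInput.{u}) (i j : ℕ) : I.ν (I.mul i j) = I.ν i * I.ν j :=
  (Nat.sInf_mem (I.exists_mul i j)).symm

theorem unifComputable_mul :
    UnifComputable data fun (I : NonFolnerInput.{u}) (x : ℕ × ℕ) => I.mul x.1 x.2 :=
  sInf (P := fun (I : NonFolnerInput.{u}) (x : ℕ × ℕ) k => I.ν x.1 * I.ν x.2 = I.ν k)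
    (unifDecidable_mul_eq (fst.comp fst) (snd.comp fst) snd) fun I x => I.exists_mul x.1 x.2

theorem unifDecidable_eq {f g : NonFolnerInput.{u} → α → ℕ} (hf : UnifComputable data f)
    (hg : UnifComputable data g) : UnifDecidable data fun I a => I.ν (f I a) = I.ν (g I a) :=
  (unifDecidable_mul_eq unifComputable_one hf hg).of_iff fun I a => by rw [ν_one, one_mul]

/-- Numbers of the elements of the `m`-th power of `K₀ ∪ {1}`. -/
noncomputable def powList (I : NonFolnerInput.{u}) (m : ℕ) : List ℕ :=
  Nat.rec [I.one] (fun _ L => (I.one :: I.l).flatMap fun k => L.map fun j => I.mul k j) m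

theorem unifComputable_powList :
    UnifComputable data fun (I : NonFolnerInput.{u}) (m : ℕ) => I.powList m := by
  have hl : UnifComputable data fun (I : NonFolnerInput.{u}) (_ : ℕ × ℕ × List ℕ) => I.l :=
    param (π := data) (f := fun γ : Nat.Partrec.Code × List ℕ × ℕ => γ.2.1)
      (Computable.fst.comp Computable.snd)
  exact nat_rec UnifComputable.id (list_cons unifComputable_one (const []))
    (list_flatMap (list_cons unifComputable_one hl)
      (list_map (f := fun (I : NonFolnerInput.{u}) (y : (ℕ × ℕ × List ℕ) × ℕ) j => I.mul y.2 j) (snd.comp (snd.comp fst))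
        (unifComputable_mul.comp ((snd.comp fst).pair snd))))

open Classical in
theorem mem_powList (I : NonFolnerInput.{u}) (m : ℕ) (g : I.G) :
    (∃ k ∈ I.powList m, I.ν k = g) ↔ g ∈ (insert 1 I.K₀) ^ m := by
  have hK : ∀ g, g ∈ I.K₀ ↔ ∃ i ∈ I.l, I.ν i = g := fun g => by
    rw [← Finset.mem_coe, I.isListOf, Set.mem_ofPred_eq]
  induction m generalizing g with
  | zero => simp [powList, ν_one, eq_comm]
  | succ m ih =>
    rw [pow_succ', Finset.mem_mul]
    change (∃ k ∈ (I.one :: I.l).flatMap fun k => (I.powList m).map fun j => I.mul k j, _) ↔ _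
    constructor
    · rintro ⟨_, hi, rfl⟩
      obtain ⟨k, hk, hi⟩ := List.mem_flatMap.1 hi
      obtain ⟨j, hj, rfl⟩ := List.mem_map.1 hi
      refine ⟨I.ν k, ?_, I.ν j, (ih _).1 ⟨j, hj, rfl⟩, (I.ν_mul k j).symm⟩
      rcases List.mem_cons.1 hk with rfl | hk
      · simp [ν_one]
      · exact Finset.mem_insert_of_mem ((hK _).2 ⟨k, hk, rfl⟩)
    · rintro ⟨y, hy, z, hz, rfl⟩
      obtain ⟨j, hj, rfl⟩ := (ih z).2 hz
      obtain ⟨k, hk, rfl⟩ : ∃ k ∈ I.one :: I.l, I.ν k = y := by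
        rcases Finset.mem_insert.1 hy with rfl | hy
        · exact ⟨I.one, List.mem_cons_self, I.ν_one⟩
        · obtain ⟨k, hk, e⟩ := (hK y).1 hy
          exact ⟨k, List.mem_cons_of_mem _ hk, e⟩
      exact ⟨I.mul k j, List.mem_flatMap.2 ⟨k, hk, List.mem_map_of_mem hj⟩, I.ν_mul k j⟩

/-- Numbers of the elements of the set `K` of translating elements. -/
noncomputable def translators (I : NonFolnerInput.{u}) : List ℕ := I.powList (2 * I.n)

theorem unifComputable_translators :
    UnifComputable data fun (I : NonFolnerInput.{u}) (_ : α) => I.translators := by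
  refine unifComputable_powList.comp (param (π := data)
    (f := fun γ : Nat.Partrec.Code × List ℕ × ℕ => 2 * γ.2.2) ?_)
  exact Primrec.nat_mul.to_comp.comp (Computable.const 2) (Computable.snd.comp Computable.snd)

/-! ### A numbering without repetitions, identifying the group with `ℕ`. -/

/-- `i` is the least number of its element. -/
def IsLeastNumber (I : NonFolnerInput.{u}) (i : ℕ) : Prop := ∀ j ∈ List.range i, ¬ I.ν j = I.ν i

theorem unifDecidable_isLeastNumber :
    UnifDecidable data fun (I : NonFolnerInput.{u}) i => I.IsLeastNumber i :=
  UnifDecidable.forall_mem_list (P := fun (I : NonFolnerInput.{u}) i j => ¬ I.ν j = I.ν i)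
    (of_computable Primrec.list_range.to_comp) (unifDecidable_eq snd fst).not

theorem exists_isLeastNumber (I : NonFolnerInput.{u}) (g : I.G) :
    ∃ i, I.IsLeastNumber i ∧ I.ν i = g := by
  classical
  have h := I.surjective g
  refine ⟨Nat.find h, fun j hj e => ?_, Nat.find_spec h⟩
  exact Nat.find_min h (List.mem_range.1 hj) (e.trans (Nat.find_spec h))

theorem IsLeastNumber.eq {I : NonFolnerInput.{u}} {i j : ℕ} (hi : I.IsLeastNumber i)
    (hj : I.IsLeastNumber j) (h : I.ν i = I.ν j) : i = j := by
  rcases lt_trichotomy i j with hlt | rfl | hlt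
  · exact absurd h (hj i (List.mem_range.2 hlt))
  · rfl
  · exact absurd h.symm (hi j (List.mem_range.2 hlt))

theorem infinite_isLeastNumber (I : NonFolnerInput.{u}) : {i | I.IsLeastNumber i}.Infinite := by
  have := I.failsFolner.infinite
  intro hfin
  refine Set.infinite_univ ((hfin.image I.ν).subset fun g _ => ?_)
  exact I.exists_isLeastNumber g

/-- The enumeration of the least numbers. -/
noncomputable def enum (I : NonFolnerInput.{u}) (j : ℕ) : ℕ := Nat.nth I.IsLeastNumber j

theorem exists_enum_lt (I : NonFolnerInput.{u}) (i : ℕ) : ∃ k, i < k ∧ I.IsLeastNumber k := by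
  obtain ⟨k, hk, hik⟩ := I.infinite_isLeastNumber.exists_gt i
  exact ⟨k, hik, hk⟩

theorem unifComputable_enum :
    UnifComputable data fun (I : NonFolnerInput.{u}) j => I.enum j := by
  have h0 : UnifComputable data fun (I : NonFolnerInput.{u}) (_ : ℕ) =>
      InfSet.sInf {i | I.IsLeastNumber i} :=
    sInf (P := fun (I : NonFolnerInput.{u}) _ i => I.IsLeastNumber i) (unifDecidable_isLeastNumber.comp snd)
      fun I _ => I.infinite_isLeastNumber.nonempty
  have h1 : UnifComputable data fun (I : NonFolnerInput.{u}) (i : ℕ) =>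
      InfSet.sInf {k | i < k ∧ I.IsLeastNumber k} :=
    sInf (P := fun (I : NonFolnerInput.{u}) i k => i < k ∧ I.IsLeastNumber k)
      ((UnifDecidable.of_primrecPred Primrec.nat_lt).and (unifDecidable_isLeastNumber.comp snd))
      exists_enum_lt
  refine (nat_rec (h := fun (I : NonFolnerInput.{u}) _ _ i => InfSet.sInf {k | i < k ∧ I.IsLeastNumber k})
    UnifComputable.id h0 (h1.comp (snd.comp snd))).of_eq fun I j => ?_
  induction j with
  | zero => exact Nat.nth_zero.symm
  | succ j ih =>
    change InfSet.sInf {k | (Nat.rec _ _ j : ℕ) < k ∧ _} = _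
    rw [ih, enum, enum, Nat.nth_eq_sInf I.IsLeastNumber (j + 1)]
    congr 1
    ext k
    -- `Nat.nth_eq_sInf` asks to exceed all earlier values; by monotonicity exceeding the last one
    -- is enough.
    have mono := (Nat.nth_strictMono I.infinite_isLeastNumber).monotone
    exact ⟨fun h => ⟨h.2, fun m hm => (mono (Nat.lt_succ_iff.1 hm)).trans_lt h.1⟩,
      fun h => ⟨h.2 j j.lt_succ_self, h.1⟩⟩

/-- The enumeration of the group without repetitions. -/
noncomputable def elt (I : NonFolnerInput.{u}) (j : ℕ) : I.G := I.ν (I.enum j)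

theorem bijective_elt (I : NonFolnerInput.{u}) : Function.Bijective I.elt := by
  refine ⟨fun i j h => ?_, fun g => ?_⟩
  · exact Nat.nth_injective I.infinite_isLeastNumber
      (IsLeastNumber.eq (Nat.nth_mem_of_infinite I.infinite_isLeastNumber i)
        (Nat.nth_mem_of_infinite I.infinite_isLeastNumber j) h)
  · obtain ⟨i, hi, rfl⟩ := I.exists_isLeastNumber g
    have : i ∈ Set.range (Nat.nth I.IsLeastNumber) := by
      rw [Nat.range_nth_of_infinite I.infinite_isLeastNumber]
      exact hi
    obtain ⟨j, rfl⟩ := this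
    exact ⟨j, rfl⟩

/-- The index of the element with number `i` in the enumeration without repetitions. -/
noncomputable def index (I : NonFolnerInput.{u}) (i : ℕ) : ℕ := sInf {j | I.ν i = I.elt j}

theorem exists_eq_elt (I : NonFolnerInput.{u}) (i : ℕ) : ∃ j, I.ν i = I.elt j :=
  (I.bijective_elt.2 _).imp fun _ h => h.symm

theorem elt_index (I : NonFolnerInput.{u}) (i : ℕ) : I.elt (I.index i) = I.ν i :=
  (Nat.sInf_mem (I.exists_eq_elt i)).symm

theorem unifComputable_index :
    UnifComputable data fun (I : NonFolnerInput.{u}) i => I.index i :=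
  sInf (P := fun (I : NonFolnerInput.{u}) i j => I.ν i = I.elt j) (unifDecidable_eq fst (unifComputable_enum.comp snd))
    exists_eq_elt

/-- The index of `k⁻¹ * g`, where `k` has number `k` and `g` has index `c`. -/
noncomputable def divIndex (I : NonFolnerInput.{u}) (k c : ℕ) : ℕ :=
  sInf {j | I.ν k * I.elt j = I.elt c}

theorem exists_divIndex (I : NonFolnerInput.{u}) (k c : ℕ) : ∃ j, I.ν k * I.elt j = I.elt c :=
  (I.bijective_elt.2 ((I.ν k)⁻¹ * I.elt c)).imp fun j h => by rw [h, mul_inv_cancel_left]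

theorem mul_elt_divIndex (I : NonFolnerInput.{u}) (k c : ℕ) :
    I.ν k * I.elt (I.divIndex k c) = I.elt c :=
  Nat.sInf_mem (I.exists_divIndex k c)

theorem unifComputable_divIndex :
    UnifComputable data fun (I : NonFolnerInput.{u}) (x : ℕ × ℕ) => I.divIndex x.1 x.2 :=
  sInf (P := fun (I : NonFolnerInput.{u}) (x : ℕ × ℕ) j => I.ν x.1 * I.elt j = I.elt x.2)
    (unifDecidable_mul_eq (fst.comp fst) (unifComputable_enum.comp snd)
      (unifComputable_enum.comp (snd.comp fst))) fun I x => I.exists_divIndex x.1 x.2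

/-! ### The two-to-one bipartite graph and its doubling property. -/

/-- Two left vertices `2 * j` and `2 * j + 1` belong to the element `g` with index `j`; they are
joined to the indices of the elements `k * g`, where `k` is a translator. -/
noncomputable def adj (I : NonFolnerInput.{u}) (a : ℕ) : List ℕ :=
  I.translators.map fun k => I.index (I.mul k (I.enum a.div2))

/-- The adjacency lists of the right vertices. -/
noncomputable def adj' (I : NonFolnerInput.{u}) (c : ℕ) : List ℕ :=
  I.translators.flatMap fun k => [2 * I.divIndex k c, 2 * I.divIndex k c + 1]

theorem unifComputable_adj : UnifComputable data fun (I : NonFolnerInput.{u}) a => I.adj a := by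
  have hdiv : UnifComputable data fun (_ : NonFolnerInput.{u}) (x : ℕ × ℕ) => x.1.div2 :=
    of_computable (Computable.nat_div2.comp Computable.fst)
  have h : UnifComputable data fun (I : NonFolnerInput.{u}) (x : ℕ × ℕ) =>
      I.mul x.2 (I.enum x.1.div2) :=
    unifComputable_mul.comp (snd.pair (unifComputable_enum.comp hdiv))
  exact list_map (f := fun (I : NonFolnerInput.{u}) (a k : ℕ) => I.index (I.mul k (I.enum a.div2)))
    unifComputable_translators (unifComputable_index.comp h)

theorem unifComputable_adj' : UnifComputable data fun (I : NonFolnerInput.{u}) c => I.adj' c := by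
  have h : UnifComputable data fun (I : NonFolnerInput.{u}) (x : ℕ × ℕ) =>
      2 * I.divIndex x.2 x.1 :=
    (of_computable (Primrec.nat_mul.to_comp.comp (Computable.const 2) Computable.id)).comp
      (unifComputable_divIndex.comp (snd.pair fst))
  exact list_flatMap (f := fun (I : NonFolnerInput.{u}) c k => [2 * I.divIndex k c, 2 * I.divIndex k c + 1])
    unifComputable_translators
    (list_cons h (list_cons ((of_computable Computable.succ).comp h) (const [])))

theorem mem_adj (I : NonFolnerInput.{u}) (a c : ℕ) :
    c ∈ I.adj a ↔ ∃ k ∈ I.translators, I.ν k * I.elt a.div2 = I.elt c := by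
  simp only [adj, List.mem_map]
  refine exists_congr fun k => and_congr_right fun _ => ?_
  rw [← I.bijective_elt.1.eq_iff, elt_index, ν_mul]
  rfl

theorem mem_adj' (I : NonFolnerInput.{u}) (a c : ℕ) :
    a ∈ I.adj' c ↔ ∃ k ∈ I.translators, I.ν k * I.elt a.div2 = I.elt c := by
  simp only [adj', List.mem_flatMap]
  refine exists_congr fun k => and_congr_right fun _ => ?_
  rw [← I.mul_elt_divIndex k c, mul_right_inj, I.bijective_elt.1.eq_iff, Nat.div2_val]
  simp only [List.mem_cons, List.not_mem_nil, or_false]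
  omega

/-- Passing from vertices to group elements loses at most a factor 2, and translation gains a factor
4. -/
theorem two_mul_card_le_adj (I : NonFolnerInput.{u}) (X : Finset ℕ) :
    2 * X.card ≤ (X.biUnion fun a => (I.adj a).toFinset).card := by
  classical
  have h1 : X.card ≤ 2 * (X.image fun a => I.elt a.div2).card := by
    refine Finset.card_le_mul_card_image X 2 fun g hg => ?_
    obtain ⟨b, -, rfl⟩ := Finset.mem_image.1 hg
    refine (Finset.card_le_card (t := {2 * b.div2, 2 * b.div2 + 1}) fun a ha => ?_).trans
      Finset.card_le_two
    have := I.bijective_elt.1 (Finset.mem_filter.1 ha).2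
    rw [Nat.div2_val, Nat.div2_val] at this
    rw [Finset.mem_insert, Finset.mem_singleton, Nat.div2_val]
    omega
  have h2 := I.failsFolner.four_mul_card_le (X.image fun a => I.elt a.div2)
  have h3 : (insert 1 I.K₀) ^ (2 * I.n) * (X.image fun a => I.elt a.div2) ⊆
      (X.biUnion fun a => (I.adj a).toFinset).image I.elt := by
    intro z hz
    obtain ⟨y, hy, w, hw, rfl⟩ := Finset.mem_mul.1 hz
    obtain ⟨a, ha, rfl⟩ := Finset.mem_image.1 hw
    obtain ⟨k, hk, rfl⟩ := (I.mem_powList _ _).2 hy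
    obtain ⟨c, hc⟩ := I.bijective_elt.2 (I.ν k * I.elt a.div2)
    refine Finset.mem_image.2 ⟨c, Finset.mem_biUnion.2 ⟨a, ha, List.mem_toFinset.2 ?_⟩, hc⟩
    exact (I.mem_adj a c).2 ⟨k, hk, hc.symm⟩
  have h4 := (Finset.card_le_card h3).trans Finset.card_image_le
  omega

/-- A single translator `k` suffices: `c ↦ k⁻¹ c` is injective and each value has two copies on the
left. The translator 1 only shows that one exists. -/
theorem two_mul_card_le_adj' (I : NonFolnerInput.{u}) (Y : Finset ℕ) :
    2 * Y.card ≤ (Y.biUnion fun c => (I.adj' c).toFinset).card := by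
  classical
  obtain ⟨k, hk, -⟩ : ∃ k ∈ I.translators, I.ν k = 1 :=
    (I.mem_powList _ _).2 (Finset.one_mem_pow (Finset.mem_insert_self _ _))
  have hinj : ∀ c d, I.divIndex k c = I.divIndex k d → c = d := fun c d h => by
    apply I.bijective_elt.1
    rw [← I.mul_elt_divIndex k c, ← I.mul_elt_divIndex k d, h]
  rw [mul_comm, ← Finset.card_range 2, ← Finset.card_product]
  refine Finset.card_le_card_of_injOn (fun x => 2 * I.divIndex k x.1 + x.2) ?_ ?_
  · rintro ⟨c, b⟩ hx
    obtain ⟨hc, hb⟩ := Finset.mem_product.1 hx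
    refine Finset.mem_coe.2 (Finset.mem_biUnion.2 ⟨c, hc, List.mem_toFinset.2 ?_⟩)
    refine List.mem_flatMap.2 ⟨k, hk, ?_⟩
    have hb' : b < 2 := Finset.mem_range.1 hb
    simp only [List.mem_cons, List.not_mem_nil, or_false]
    omega
  · rintro ⟨c, b⟩ hx ⟨d, b'⟩ hy h
    have hb : b < 2 := Finset.mem_range.1 (Finset.mem_product.1 hx).2
    have hb' : b' < 2 := Finset.mem_range.1 (Finset.mem_product.1 hy).2
    simp only at h
    have h1 := hinj c d (by omega)
    subst h1
    exact Prod.ext rfl (by simp only; omega)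

/-! ### From the computable matching to programs for the pieces. -/

theorem exists_presentation :
    ∃ out : NonFolnerInput.{u} → List (ℕ × Nat.Partrec.Code × Nat.Partrec.Code),
      (UnifComputable data fun I (_ : Unit) => out I) ∧
      ∀ I, PresentsEffectiveParadoxicalDecomposition I.ν (out I) := by
  classical
  obtain ⟨f, hf, hfI⟩ := exists_unifComputable_bijective unifComputable_adj.{u}
    unifComputable_adj' (fun I a c => (I.mem_adj a c).trans (I.mem_adj' a c).symm)
    two_mul_card_le_adj two_mul_card_le_adj'
  have hpiece : UnifDecidable data fun (I : NonFolnerInput.{u}) (x : (ℕ × ℕ) × ℕ) =>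
      I.ν x.1.1 * I.ν x.2 = I.elt (f I (2 * I.index x.2 + x.1.2)) := by
    refine unifDecidable_mul_eq (fst.comp fst) snd (unifComputable_enum.comp (hf.comp ?_))
    exact (of_computable (Primrec.nat_add.to_comp)).comp
      (((of_computable (Primrec.nat_mul.to_comp.comp (Computable.const 2) Computable.id)).comp
        (unifComputable_index.comp snd)).pair (snd.comp fst))
  obtain ⟨C, hC, hCd⟩ := UnifDecidable.exists_decides (P := fun (I : NonFolnerInput.{u}) (y : ℕ × ℕ) i =>
    I.ν y.1 * I.ν i = I.elt (f I (2 * I.index i + y.2))) hpiece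
  refine ⟨fun I => I.translators.map fun k => (k, C I.data (k, 0), C I.data (k, 1)), ?_,
    fun I => ?_⟩
  · refine list_map (f := fun (I : NonFolnerInput.{u}) _ k => (k, C (data I) (k, 0), C (data I) (k, 1)))
      unifComputable_translators (snd.pair ((hC.comp (snd.pair (const 0))).pair
        (hC.comp (snd.pair (const 1)))))
  obtain ⟨hbij, hadj⟩ := hfI I
  -- `r g` is the index of `g`, so its two copies are the left vertices `2 * r g + b` with `b = 0`
  -- for `φ` and `b = 1` for `ψ`.
  let r : I.G → ℕ := Function.surjInv I.bijective_elt.2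
  have hr : ∀ g, I.elt (r g) = g := Function.surjInv_eq _
  have hrν : ∀ i, r (I.ν i) = I.index i := fun i =>
    I.bijective_elt.1 ((hr _).trans (I.elt_index i).symm)
  have hinj : ∀ b < 2, ∀ b' < 2, ∀ x y,
      I.elt (f I (2 * r x + b)) = I.elt (f I (2 * r y + b')) → x = y ∧ b = b' := by
    intro b hb b' hb' x y h
    have h1 := hbij.1 (I.bijective_elt.1 h)
    refine ⟨?_, by omega⟩
    rw [← hr x, ← hr y, show r x = r y by omega]
  have hK : ∀ b < 2, ∀ x, ∃ k ∈ (I.translators.map I.ν).toFinset,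
      k * x = I.elt (f I (2 * r x + b)) := by
    intro b hb x
    obtain ⟨k, hk, h⟩ := (I.mem_adj _ _).1 (hadj (2 * r x + b))
    refine ⟨I.ν k, List.mem_toFinset.2 (List.mem_map_of_mem hk), ?_⟩
    rwa [Nat.div2_val, show (2 * r x + b) / 2 = r x by omega, hr] at h
  refine ⟨(I.translators.map I.ν).toFinset, _, _, isParadoxicalDecomposition_of_injective
    (φ := fun x => I.elt (f I (2 * r x + 0))) (ψ := fun x => I.elt (f I (2 * r x + 1)))
    (fun x y h => (hinj 0 (by simp) 0 (by simp) x y h).1)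
    (fun x y h => (hinj 1 (by simp) 1 (by simp) x y h).1)
    (fun x y h => zero_ne_one (hinj 0 (by simp) 1 (by simp) x y h).2)
    (fun z => ?_) (hK 0 (by simp)) (hK 1 (by simp)), ?_, ?_⟩
  · obtain ⟨c, rfl⟩ := I.bijective_elt.2 z
    obtain ⟨a, rfl⟩ := hbij.2 c
    have hra : r (I.elt (a / 2)) = a / 2 := I.bijective_elt.1 (hr _)
    -- The parity of the left partner `a` tells which of the two injections hits the element.
    rcases Nat.mod_two_eq_zero_or_one a with h | h
    · refine Or.inl ⟨I.elt (a / 2), ?_⟩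
      simp only [hra]
      congr 2
      omega
    · refine Or.inr ⟨I.elt (a / 2), ?_⟩
      simp only [hra]
      congr 2
      omega
  · ext g
    simp
  · intro t ht
    obtain ⟨k, -, rfl⟩ := List.mem_map.1 ht
    have h0 := hCd I (k, 0)
    have h1 := hCd I (k, 1)
    simp only [Set.mem_ofPred_eq, hrν]
    exact ⟨h0, h1⟩

end NonFolnerInput

theorem mainTheorem2 :
    (∀ (G : Type u) [Group G] (ν : ℕ → G), IsComputableGroup ν →
      ∃ Φ : List ℕ →. List (ℕ × Nat.Partrec.Code × Nat.Partrec.Code), Partrec Φ ∧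
        ∀ (K₀ : Finset G) (l : List ℕ), IsListOf ν l K₀ → (∃ n : ℕ, FailsFolner K₀ n) →
          ∃ out ∈ Φ l, PresentsEffectiveParadoxicalDecomposition ν out) ∧
    (∃ Ψ : Nat.Partrec.Code × List ℕ × ℕ →. List (ℕ × Nat.Partrec.Code × Nat.Partrec.Code),
      Partrec Ψ ∧
        ∀ (G : Type u) [Group G] (ν : ℕ → G) (e : Nat.Partrec.Code),
          Function.Surjective ν → Decides e (MultT ν) →
          ∀ (K₀ : Finset G) (l : List ℕ) (n : ℕ), IsListOf ν l K₀ → FailsFolner K₀ n →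
            ∃ out ∈ Ψ (e, l, n), PresentsEffectiveParadoxicalDecomposition ν out) := by
  classical
  obtain ⟨out, ⟨F, hF, hF'⟩, hout⟩ := NonFolnerInput.exists_presentation.{u}
  have hΨ : Partrec fun γ => F (γ, ()) := hF.comp (Computable.id.pair (Computable.const ()))
  have key : ∀ (G : Type u) [Group G] (ν : ℕ → G) (e : Nat.Partrec.Code),
      Function.Surjective ν → Decides e (MultT ν) →
      ∀ (K₀ : Finset G) (l : List ℕ) (n : ℕ), IsListOf ν l K₀ → FailsFolner K₀ n →
        ∃ out ∈ F ((e, l, n), ()), PresentsEffectiveParadoxicalDecomposition ν out := by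
    intro G _ ν e hν he K₀ l n hl hn
    let I : NonFolnerInput.{u} := ⟨G, ν, e, l, n, K₀, hν, he, hl, hn⟩
    exact ⟨out I, Part.eq_some_iff.1 (hF' I ()), hout I⟩
  refine ⟨fun G _ ν hν => ?_, fun γ => F (γ, ()), hΨ, key⟩
  obtain ⟨e, he⟩ := hν.computable_multT.exists_decides
  -- This case distinction need not be effective, as the procedure in (1) may depend on the group.
  by_cases h : ∃ (K₁ : Finset G) (l₁ : List ℕ) (n₁ : ℕ), IsListOf ν l₁ K₁ ∧ FailsFolner K₁ n₁
  · -- Adjoining one fixed set with a known Følner constant makes the constant of `K₀` irrelevant.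
    obtain ⟨K₁, l₁, n₁, hl₁, hn₁⟩ := h
    refine ⟨fun l => F ((e, l ++ l₁, n₁), ()), hΨ.comp ((Computable.const e).pair
      ((Computable.list_append.comp Computable.id (Computable.const l₁)).pair
        (Computable.const n₁))), fun K₀ l hl _ => ?_⟩
    refine key G ν e hν.surjective he (K₀ ∪ K₁) (l ++ l₁) n₁ ?_
      (hn₁.mono Finset.subset_union_right)
    simp only [IsListOf] at hl hl₁ ⊢
    rw [Finset.coe_union, hl, hl₁]
    ext g
    simp [or_and_right, exists_or]
  · exact ⟨fun _ => Part.none, Partrec.none, fun K₀ l hl ⟨n, hn⟩ => (h ⟨K₀, l, n, hl, hn⟩).elim⟩
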